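/- **Theorem.** Let $d\ge 1$, $X=\mathbb R^d$, $\mathbb R_+=(0,\infty)$. Let $\mathcal B_0(X)$ be the family of Borel sets of $X$ with compact closure. Let $\mathbb K(X)$ be the set of discrete Radon measures $\eta=\sum_i s_i\delta_{x_i}$ on $X$ (at most countably many distinct atoms $x_i\in X$, weights $s_i>0$, $\eta$ finite on compact sets), with the $\sigma$-algebra generated by the maps $\eta\mapsto\eta(A)$, $A\in\mathcal B_0(X)$. Let $l:X\times\mathbb R_+\to[0,\infty)$ be measurable and such that, for each $x\in X$, either $l(x,s)>0$ for all $s\in\mathbb R_+$ or $l(x,s)=0$ for all $s\in\mathbb R_+$. Let $Y$ be the set of all $x\in X$ for which the first alternative holds, let $\mathcal B_0(Y)=\{A\in\mathcal B_0(X): A\subset Y\}$, and let $m$ be the measure $dm(x,s)=\frac{l(x,s)}{s}\,dx\,ds$ on $X\times\mathbb R_+$. Assume that 1. $l(x,\cdot)>0$ for almost every $x$, i.e. $X\setminus Y$ has Lebesgue measure $0$; 2. $\int_A\int_{\mathbb R_+} l(x,s)\min\{s^{-1},1\}\,ds\,dx<\infty$ for all $A\in\mathcal B_0(Y)$; 3.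 for each $n\in\mathbb N$, $n\ge1$, there is $\epsilon>0$ such that, for each $A\in\mathcal B_0(Y)$, $$\int_A\Big[\sup_{r\in[\frac1n,n]}\int_{(0,\epsilon)}\frac{|l(x,rs)-l(x,s)|}{s}\,ds\Big]dx<\infty;$$ 4. $m(\Lambda\times\mathbb R_+)=\infty$ for some $\Lambda\in\mathcal B_0(X)$. Then there is exactly one probability measure $\mu_m$ on $\mathbb K(X)$ (the completely random discrete measure with Lévy measure $m$) such that, for every continuous $f:X\to\mathbb R$ with compact support, $$\int_{\mathbb K(X)}e^{i\int f\,d\eta}\,d\mu_m(\eta)=\exp\Big[\int_{X\times\mathbb R_+}\big(e^{isf(x)}-1\big)\,dm(x,s)\Big],$$ and $\mu_m$ is partially quasi-invariant with respect to the action of the following group $\mathfrak G$. *The group.* $\operatorname{Diff}_0(X)$ is the group of $C^\infty$ diffeomorphisms of $X$ that are the identity outside a compact set, and $C_0(X\to\mathbb R_+)$ is the multiplicative group of continuous functions $\theta:X\to\mathbb R_+$ that are equal to $1$ outside a compact set. $\mathfrak G=\operatorname{Diff}_0(X)\ltimes C_0(X\to\mathbb R_+)$ is the set of pairs $g=(\varphi,\theta)$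 with the product $(\varphi_1,\theta_1)(\varphi_2,\theta_2)=(\varphi_1\circ\varphi_2,\ \theta_1\cdot(\theta_2\circ\varphi_1^{-1}))$. It acts on $\mathbb K(X)$ by $d(g\eta)=\theta\,d(\varphi^*\eta)$, where $\varphi^*\eta$ is the pushforward of $\eta$ under $\varphi$. *Partial quasi-invariance.* A probability measure $P$ on $(\Omega,\mathcal F)$, on which a group $G$ acts by measurable maps, is partially quasi-invariant with respect to $G$ if there is an increasing sequence $(\mathcal F_n)_{n\ge1}$ of sub-$\sigma$-algebras of $\mathcal F$ such that (a) $\mathcal F$ is the smallest $\sigma$-algebra containing all $\mathcal F_n$; (b) for all $g\in G$ and $n$ there is $k$ with $gA\in\mathcal F_k$ for all $A\in\mathcal F_n$; (c) for all $g\in G$ and $n$ there is an $\mathcal F$-measurable $R_g^{(n)}:\Omega\to[0,\infty]$ such that, for every $\mathcal F_n$-measurable $F:\Omega\to[0,\infty]$, $$\int_\Omega F\,dP^g=\int_\Omega F\,R_g^{(n)}\,dP ,$$ where $P^g$ is the pushforward of $P$ under $g$. Moreover, for $P=\mu_m$ and $G=\mathfrak G$, conditions (a)–(c) hold for the filtration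 generated by the atoms of weight at least $1/n$: $\mathcal F_n$ is the smallest $\sigma$-algebra on $\mathbb K(X)$ that makes measurable all maps $\eta\mapsto\#\{x\in X:(x,\eta(\{x\}))\in\Lambda\}$, with $\Lambda\subset X\times[\frac1n,\infty)$ Borel and relatively compact. -/

import Mathlib

open MeasureTheory Set
open scoped ENNReal

namespace PQI

/-- The space `X = ℝᵈ`. -/
abbrev Rd (d : ℕ) : Type := EuclideanSpace ℝ (Fin d)

/-! ### The space of discrete Radon measures -/

/-- `η` is a discrete Radon measure: it is finite on compact sets and of the form
`∑ x ∈ τ, s x • δ_x` with `τ` countable (possibly empty) and weights `0 < s x < ∞`. -/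
def IsDiscreteRadon {d : ℕ} (η : Measure (Rd d)) : Prop :=
  (∀ K : Set (Rd d), IsCompact K → η K < ∞) ∧
  ∃ (τ : Set (Rd d)) (s : Rd d → ℝ), τ.Countable ∧ (∀ x ∈ τ, 0 < s x) ∧
    η = Measure.sum fun x : τ => ENNReal.ofReal (s x) • Measure.dirac (x : Rd d)

/-- The cone `𝕂(X)` of discrete Radon measures. Its σ-algebra is the trace of the σ-algebra on
measures generated by the evaluations `η ↦ η A`, `A` Borel; on Radon measures this is the Borel
σ-algebra of the vague topology. -/
abbrev DiscreteRadon (d : ℕ) : Type := {η : Measure (Rd d) // IsDiscreteRadon η}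

/-! ### The groups -/

/-- `Diff₀(X)`: smooth diffeomorphisms of `X` equal to the identity outside a compact set, with
composition as product. -/
def Diff0 (d : ℕ) : Subgroup (Equiv.Perm (Rd d)) where
  carrier := {φ | ContDiff ℝ (⊤ : ℕ∞) (φ : Rd d → Rd d) ∧ ContDiff ℝ (⊤ : ℕ∞) (φ.symm : Rd d → Rd d) ∧
    ∃ K : Set (Rd d), IsCompact K ∧ ∀ x ∉ K, φ x = x}
  one_mem' := ⟨contDiff_id, contDiff_id, ∅, isCompact_empty, fun _ _ => rfl⟩
  mul_mem' := by
    rintro φ ψ ⟨h1, h2, K, hK, h3⟩ ⟨h1', h2', K', hK', h3'⟩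
    refine ⟨h1.comp h1', h2'.comp h2, K ∪ K', hK.union hK', fun x hx => ?_⟩
    rw [mem_union, not_or] at hx
    rw [Equiv.Perm.mul_apply, h3' x hx.2, h3 x hx.1]
  inv_mem' := by
    rintro φ ⟨h1, h2, K, hK, h3⟩
    exact ⟨h2, h1, K, hK, fun x hx => φ.injective ((φ.apply_symm_apply x).trans (h3 x hx).symm)⟩

theorem Diff0.measurable {d : ℕ} (φ : Diff0 d) : Measurable (φ.1 : Rd d → Rd d) :=
  φ.2.1.continuous.measurable

/-- `C₀(X → ℝ₊)`: continuous functions with values in `(0, ∞)` equal to `1` outside a compact set,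
with the pointwise product. -/
def Current (d : ℕ) : Subgroup (Rd d → {r : ℝ // 0 < r}) where
  carrier := {θ | Continuous θ ∧ ∃ K : Set (Rd d), IsCompact K ∧ ∀ x ∉ K, θ x = 1}
  one_mem' := ⟨continuous_const, ∅, isCompact_empty, fun _ _ => rfl⟩
  mul_mem' := by
    rintro θ ζ ⟨h1, K, hK, h2⟩ ⟨h1', K', hK', h2'⟩
    refine ⟨?_, K ∪ K', hK.union hK', fun x hx => ?_⟩
    · exact Continuous.subtype_mk
        ((continuous_subtype_val.comp h1).mul (continuous_subtype_val.comp h1')) _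
    · rw [mem_union, not_or] at hx
      rw [Pi.mul_apply, h2 x hx.1, h2' x hx.2, one_mul]
  inv_mem' := by
    rintro θ ⟨h1, K, hK, h2⟩
    refine ⟨?_, K, hK, fun x hx => ?_⟩
    · exact Continuous.subtype_mk
        ((continuous_subtype_val.comp h1).inv₀ fun x => (θ x).2.ne') _
    · rw [Pi.inv_apply, h2 x hx, inv_one]

/-- The function `θ ∈ C₀(X → ℝ₊)` as a density with values in `[0, ∞]`. -/
noncomputable def Current.density {d : ℕ} (θ : Current d) (x : Rd d) : ℝ≥0∞ :=
  ENNReal.ofReal (θ.1 x : ℝ)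

theorem Current.measurable_density {d : ℕ} (θ : Current d) : Measurable (Current.density θ) :=
  ENNReal.measurable_ofReal.comp (continuous_subtype_val.comp θ.2.1).measurable

theorem Current.density_mul {d : ℕ} (θ ζ : Current d) (x : Rd d) :
    (Current.density (θ * ζ)) x = (Current.density θ) x * (Current.density ζ) x :=
  ENNReal.ofReal_mul (θ.1 x).2.le

theorem Current.comp_inv_mem {d : ℕ} (φ : Diff0 d) (θ : Current d) :
    (fun x => θ.1 ((φ⁻¹).1 x)) ∈ Current d := by
  obtain ⟨K', hK', h2'⟩ := (φ⁻¹).2.2.2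
  obtain ⟨h1, K, hK, h2⟩ := θ.2
  refine ⟨h1.comp (φ⁻¹).2.1.continuous, K ∪ K', hK.union hK', fun x hx => ?_⟩
  rw [mem_union, not_or] at hx
  have : (φ⁻¹).1 x = x := h2' x hx.2
  change θ.1 ((φ⁻¹).1 x) = 1
  rw [this, h2 x hx.1]

/-- The action of `Diff₀(X)` on `C₀(X → ℝ₊)` by automorphisms, `α(φ) θ = θ ∘ φ⁻¹`. -/
def actionHom (d : ℕ) : Diff0 d →* MulAut (Current d) where
  toFun φ :=
    { toFun := fun θ => ⟨fun x => θ.1 ((φ⁻¹).1 x), Current.comp_inv_mem φ θ⟩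
      invFun := fun θ => ⟨fun x => θ.1 ((φ⁻¹⁻¹).1 x), Current.comp_inv_mem φ⁻¹ θ⟩
      left_inv := fun θ => Subtype.ext (funext fun x => congrArg θ.1 (φ.1.symm_apply_apply x))
      right_inv := fun θ => Subtype.ext (funext fun x => congrArg θ.1 (φ.1.apply_symm_apply x))
      map_mul' := fun _ _ => rfl }
  map_one' := rfl
  map_mul' := fun _ _ => rfl

/-- The semidirect product `𝔊` of `Diff₀(X)` and `C₀(X → ℝ₊)`. An element is a pair of
`g.right = φ` and `g.left = θ`, and
`(φ₁, θ₁) (φ₂, θ₂) = (φ₁ ∘ φ₂, θ₁ (θ₂ ∘ φ₁⁻¹))`. -/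
abbrev DiffCurrent (d : ℕ) : Type := Current d ⋊[actionHom d] Diff0 d

/-! ### The action on discrete Radon measures -/

/-- The action of `g = (φ, θ)` on measures: `d(gη) = θ d(φ^* η)`, with `φ^* η` the pushforward. -/
noncomputable def actMeasure {d : ℕ} (g : DiffCurrent d) (η : Measure (Rd d)) : Measure (Rd d) :=
  (η.map (g.right.1 : Rd d → Rd d)).withDensity (Current.density g.left)

theorem measurable_indicator_act {d : ℕ} (g : DiffCurrent d) {A : Set (Rd d)}
    (hA : MeasurableSet A) :
    Measurable fun x => A.indicator (Current.density g.left) (g.right.1 x) :=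
  ((Current.measurable_density g.left).indicator hA).comp (Diff0.measurable g.right)

theorem actMeasure_apply {d : ℕ} (g : DiffCurrent d) (η : Measure (Rd d)) {A : Set (Rd d)}
    (hA : MeasurableSet A) :
    actMeasure g η A =
      ∫⁻ x, A.indicator (Current.density g.left) (g.right.1 x) ∂η := by
  rw [actMeasure, withDensity_apply _ hA, ← lintegral_indicator hA,
    lintegral_map ((Current.measurable_density g.left).indicator hA) (Diff0.measurable g.right)]

theorem actMeasure_one {d : ℕ} (η : Measure (Rd d)) : actMeasure 1 η = η := by
  ext A hA
  rw [actMeasure_apply _ _ hA]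
  have : ∀ x : Rd d, A.indicator (Current.density (1 : DiffCurrent d).left) ((1 : DiffCurrent d).right.1 x)
      = A.indicator 1 x := by
    intro x
    by_cases hx : x ∈ A
    · simp [Current.density, hx]
    · simp [hx]
  rw [lintegral_congr this, lintegral_indicator_one hA]

theorem actMeasure_mul {d : ℕ} (g h : DiffCurrent d) (η : Measure (Rd d)) :
    actMeasure (g * h) η = actMeasure g (actMeasure h η) := by
  ext A hA
  rw [actMeasure_apply _ _ hA, actMeasure_apply _ _ hA]
  rw [actMeasure.eq_def h, lintegral_withDensity_eq_lintegral_mul _ (Current.measurable_density h.left)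
    (measurable_indicator_act g hA),
    lintegral_map ((Current.measurable_density h.left).mul
      (measurable_indicator_act g hA)) (Diff0.measurable h.right)]
  refine lintegral_congr fun x => ?_
  have e : (g * h).right.1 x = g.right.1 (h.right.1 x) := rfl
  rw [e, Pi.mul_apply]
  by_cases hx : g.right.1 (h.right.1 x) ∈ A
  · rw [indicator_of_mem hx, indicator_of_mem hx, SemidirectProduct.mul_left, Current.density_mul,
      mul_comm]
    congr 1
    change ENNReal.ofReal (h.left.1 (g.right.1.symm (g.right.1 (h.right.1 x)))) = _
    rw [Equiv.symm_apply_apply]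
    rfl
  · rw [indicator_of_notMem hx, indicator_of_notMem hx, mul_zero]

theorem actMeasure_isDiscreteRadon {d : ℕ} (g : DiffCurrent d) {η : Measure (Rd d)}
    (hη : IsDiscreteRadon η) : IsDiscreteRadon (actMeasure g η) := by
  obtain ⟨hfin, τ, s, hτ, hs, rfl⟩ := hη
  have hφ := (Diff0.measurable g.right)
  refine ⟨fun K hK => ?_, g.right.1 '' τ,
    fun y => g.left.1 y * s (g.right.1.symm y), hτ.image _, ?_, ?_⟩
  · have hθc : Continuous fun x => (g.left.1 x : ℝ) := continuous_subtype_val.comp g.left.2.1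
    obtain ⟨C, hC⟩ := (hK.image hθc).bddAbove
    have hK' : IsCompact ((g.right.1 : Rd d → Rd d) ⁻¹' K) := by
      have : (g.right.1 : Rd d → Rd d) ⁻¹' K = g.right.1.symm '' K :=
        (g.right.1.image_symm_eq_preimage K).symm
      rw [this]
      exact hK.image g.right.2.2.1.continuous
    rw [actMeasure, withDensity_apply _ hK.measurableSet]
    calc ∫⁻ x in K, (Current.density g.left) x ∂(Measure.map _ _)
        ≤ ∫⁻ _ in K, ENNReal.ofReal C ∂(Measure.map _ _) :=
          setLIntegral_mono measurable_const fun x hx =>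
            ENNReal.ofReal_le_ofReal (hC (mem_image_of_mem _ hx))
      _ < ∞ := by
          rw [setLIntegral_const, Measure.map_apply hφ hK.measurableSet]
          exact ENNReal.mul_lt_top ENNReal.ofReal_lt_top (hfin _ hK')
  · rintro _ ⟨x, hx, rfl⟩
    simpa using mul_pos (g.left.1 (g.right.1 x)).2 (hs x hx)
  · ext A hA
    rw [actMeasure_apply _ _ hA, lintegral_sum_measure, Measure.sum_apply _ hA]
    rw [← (g.right.1.image τ).tsum_eq fun y : g.right.1 '' τ =>
      (ENNReal.ofReal (g.left.1 (y : Rd d) * s (g.right.1.symm y)) •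
        Measure.dirac (y : Rd d)) A]
    refine tsum_congr fun x => ?_
    rw [lintegral_smul_measure, lintegral_dirac' _
      (measurable_indicator_act g hA), Measure.smul_apply,
      Measure.dirac_apply' _ hA, Equiv.image_apply_coe, Equiv.symm_apply_apply,
      ENNReal.ofReal_mul (g.left.1 _).2.le, smul_eq_mul, smul_eq_mul]
    by_cases hx : g.right.1 x ∈ A
    · simp [hx, Current.density, mul_comm]
    · simp [hx]

noncomputable instance instMulActionDiscreteRadon (d : ℕ) :
    MulAction (DiffCurrent d) (DiscreteRadon d) where
  smul g η := ⟨actMeasure g η.1, actMeasure_isDiscreteRadon g η.2⟩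
  one_smul η := Subtype.ext (actMeasure_one η.1)
  mul_smul g h η := Subtype.ext (actMeasure_mul g h η.1)

instance instMeasurableConstSMulDiscreteRadon (d : ℕ) :
    MeasurableConstSMul (DiffCurrent d) (DiscreteRadon d) where
  measurable_const_smul g := by
    refine Measurable.subtype_mk (Measure.measurable_of_measurable_coe _ fun A hA => ?_)
    simp_rw [actMeasure_apply _ _ hA]
    exact (Measure.measurable_lintegral
      (measurable_indicator_act g hA)).comp
      measurable_subtype_coe

/-! ### Partial quasi-invariance -/

/-- The probability measure `P` is partially quasi-invariant under the action of `G` along the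
family `ℱ` of σ-algebras:
* `ℱ` is a filtration (increasing) and the σ-algebra of `Ω` is the smallest one containing all
  `ℱ n`;
* for all `g` and `n` there is `k` such that `g` maps `ℱ n` into `ℱ k`;
* for all `g` and `n`, the pushforward `P^g` has on `ℱ n` a measurable density
  `R : Ω → [0, ∞]` with respect to `P`. -/
def PartiallyQuasiInvariantAlong (G : Type*) {Ω : Type*} [Group G] [mΩ : MeasurableSpace Ω]
    [MulAction G Ω] [MeasurableConstSMul G Ω] (ℱ : ℕ → MeasurableSpace Ω) (P : Measure Ω) :
    Prop :=
  Monotone ℱ ∧ ⨆ n, ℱ n = mΩ ∧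
  (∀ (g : G) (n : ℕ), ∃ k : ℕ, ∀ A : Set Ω, MeasurableSet[ℱ n] A →
    MeasurableSet[ℱ k] ((fun ω => g • ω) '' A)) ∧
  (∀ (g : G) (n : ℕ), ∃ R : Ω → ℝ≥0∞, Measurable R ∧
    ∀ F : Ω → ℝ≥0∞, Measurable[ℱ n] F →
      ∫⁻ ω, F ω ∂(P.map fun ω => g • ω) = ∫⁻ ω, F ω * R ω ∂P)

/-- `P` is partially quasi-invariant under the action of `G`: the above holds along some
filtration. -/
def PartiallyQuasiInvariant (G : Type*) {Ω : Type*} [Group G] [MeasurableSpace Ω]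
    [MulAction G Ω] [MeasurableConstSMul G Ω] (P : Measure Ω) : Prop :=
  ∃ ℱ : ℕ → MeasurableSpace Ω, PartiallyQuasiInvariantAlong G ℱ P

/-- The σ-algebra on `𝕂(X)` generated by the atoms of weight at least `1 / (n + 1)`: the smallest
one that makes measurable all numbers `#{(x, s) ∈ Λ : x is an atom of η with weight s}` with
`Λ ⊆ X × [1 / (n + 1), ∞)` Borel and relatively compact. -/
@[reducible] noncomputable def weightFiltration (d : ℕ) (n : ℕ) : MeasurableSpace (DiscreteRadon d) :=
  ⨆ (Λ : Set (Rd d × ℝ)) (_ : MeasurableSet Λ) (_ : IsCompact (closure Λ))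
    (_ : Λ ⊆ univ ×ˢ Ici (1 / ((n : ℝ) + 1))),
    MeasurableSpace.comap
      (fun η : DiscreteRadon d => {x : Rd d | (x, (η.1 {x}).toReal) ∈ Λ}.encard) ⊤

/-! ### Completely random discrete measures given by their Lévy measure -/

/-- The Lévy measure `dm(x, s) = l(x, s) / s dx ds` on `X × (0, ∞)`, as a measure on `X × ℝ`
concentrated on `X × (0, ∞)`. -/
noncomputable def levyMeasure {d : ℕ} (l : Rd d → ℝ → ℝ) : Measure (Rd d × ℝ) :=
  ((volume : Measure (Rd d)).prod ((volume : Measure ℝ).restrict (Ioi 0))).withDensity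
    fun p => ENNReal.ofReal (l p.1 p.2 / p.2)

/-- `μ` is the completely random discrete measure `μ_m` with Lévy measure `m`: the probability
measure on `𝕂(X)` with Fourier transform
`∫ exp(i⟨f, η⟩) dμ(η) = exp(∫ (exp(i s f(x)) - 1) dm(x, s))` for all `f` continuous with compact
support. -/
def IsCompletelyRandomWithLevyMeasure {d : ℕ} (m : Measure (Rd d × ℝ))
    (μ : Measure (DiscreteRadon d)) : Prop :=
  IsProbabilityMeasure μ ∧
  ∀ f : Rd d → ℝ, Continuous f → HasCompactSupport f →
    ∫ η : DiscreteRadon d, Complex.exp (Complex.I * ((∫ x, f x ∂η.1 : ℝ) : ℂ)) ∂μ =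
      Complex.exp (∫ p : Rd d × ℝ, (Complex.exp (Complex.I * ((p.2 * f p.1 : ℝ) : ℂ)) - 1) ∂m)

/-- `Y`, the set of all `x` with `l(x, ·) > 0` on `(0, ∞)`. -/
def posSet {d : ℕ} (l : Rd d → ℝ → ℝ) : Set (Rd d) := {x | ∀ s : ℝ, 0 < s → 0 < l x s}

/-- `A ∈ 𝓑₀(Y)`: `A` is a Borel subset of `Y` whose closure in `X` is compact. -/
def IsBddBorelIn {d : ℕ} (Y A : Set (Rd d)) : Prop :=
  MeasurableSet A ∧ IsCompact (closure A) ∧ A ⊆ Y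

end PQI

namespace PQI

/-! ### Discrete Radon measures: structure and measurability -/

/-! Existence. For a finite measure `ν` on `X × (0, ∞)` the law is compound Poisson: a Poisson
number of independent atoms, i.e. the exponential series `finiteLaw ν` of the convolution powers
`convPow ν k`. Multiplicative functionals integrate over it to an explicit exponential
(`integral_finiteLaw`). The Lévy measure `m` is s-finite, hence a countable sum of finite measures;
independent summands are added up, and a Laplace transform estimate (`measure_sum_eq_top_le`) with
the integrability of `min 1 s` over bounded sets shows that the sum is almost surely locally finite.

Uniqueness. Linear combinations of test functions are test functions, so the Fourier transform fixes
all finite-dimensional laws of the integrals `∫ f dη`, and these integrals generate the σ-algebra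
(`measure_ext_of_fourier`).

Quasi-invariance. The image of `μ_m` under `g` is the completely random measure whose Lévy measure
`m'` is the image of `m` under `(x, s) ↦ (φ x, θ(φ x) s)`. As `l > 0` almost everywhere, `m` has the
same null sets as Lebesgue measure on `X × (0, ∞)`, a class preserved by this map; so `m' ≪ m`.
Moreover `m' = m` off `K × (0, ∞)` for some compact `K`. The `n`-th σ-algebra ignores atoms lighter
than some `c > 0`, so on it only jumps of size at least `c` count: those off `K` have the same law
on both sides, and those over `K` come from finite Lévy measures, whose laws inherit absolute
continuity term by term in the exponential series. Hence the image law is absolutely continuous on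
each σ-algebra of the filtration (`apply_eq_zero_of_absolutelyContinuous`), and Radon–Nikodym gives
the density. No integrability of the ratio of Lévy densities is needed. -/

theorem lintegral_eq_tsum_of_countable {α : Type*} [MeasurableSpace α] [MeasurableSingletonClass α]
    {η : Measure α} {τ : Set α} (hτ : τ.Countable) (h0 : η τᶜ = 0) (f : α → ℝ≥0∞) :
    ∫⁻ x, f x ∂η = ∑' x, f x * η {x} := by
  have h1 : ∫⁻ x, f x ∂η = ∫⁻ x in τ, f x ∂η := by
    rw [Measure.restrict_eq_self_of_ae_mem]
    exact h0
  rw [h1, lintegral_countable _ hτ, tsum_subtype τ fun x => f x * η {x}]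
  refine tsum_congr fun x => ?_
  by_cases hx : x ∈ τ
  · rw [indicator_of_mem hx]
  · rw [indicator_of_notMem hx, measure_mono_null (singleton_subset_iff.2 hx) h0, mul_zero]

theorem IsDiscreteRadon.exists_countable {d : ℕ} {η : Measure (Rd d)} (h : IsDiscreteRadon η) :
    ∃ τ : Set (Rd d), τ.Countable ∧ η τᶜ = 0 := by
  obtain ⟨-, τ, s, hτ, -, rfl⟩ := h
  refine ⟨τ, hτ, ?_⟩
  rw [Measure.sum_apply _ hτ.measurableSet.compl]
  simp

/-- Being carried by a countable set passes at once to finite and countable sums, whereas in an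
explicit representation coinciding atoms would have to be merged. -/
theorem isDiscreteRadon_of_countable {d : ℕ} {η : Measure (Rd d)}
    (hfin : ∀ K : Set (Rd d), IsCompact K → η K < ∞) {τ : Set (Rd d)} (hτ : τ.Countable)
    (h0 : η τᶜ = 0) : IsDiscreteRadon η := by
  refine ⟨hfin, {x ∈ τ | η {x} ≠ 0}, fun x => (η {x}).toReal, hτ.mono (sep_subset _ _),
    fun x hx => ENNReal.toReal_pos hx.2 (hfin _ isCompact_singleton).ne, ?_⟩
  ext A hA
  rw [Measure.sum_apply _ hA, ← lintegral_indicator_one hA, lintegral_eq_tsum_of_countable hτ h0,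
    tsum_subtype {x ∈ τ | η {x} ≠ 0} fun x =>
      (ENNReal.ofReal (η {x}).toReal • Measure.dirac x : Measure (Rd d)) A]
  refine tsum_congr fun x => ?_
  by_cases hx : x ∈ {x ∈ τ | η {x} ≠ 0}
  · rw [indicator_of_mem hx, Measure.smul_apply, Measure.dirac_apply' _ hA, smul_eq_mul,
      ENNReal.ofReal_toReal (hfin _ isCompact_singleton).ne, mul_comm]
  · rw [indicator_of_notMem hx]
    by_cases hτx : x ∈ τ
    · have : η {x} = 0 := by
        by_contra h
        exact hx ⟨hτx, h⟩
      rw [this, mul_zero]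
    · rw [measure_mono_null (singleton_subset_iff.2 hτx) h0, mul_zero]

namespace DiscreteRadon

variable {d : ℕ}

theorem lintegral_eq_tsum (η : DiscreteRadon d) (f : Rd d → ℝ≥0∞) :
    ∫⁻ x, f x ∂η.1 = ∑' x, f x * η.1 {x} := by
  obtain ⟨τ, hτ, h0⟩ := η.2.exists_countable
  exact lintegral_eq_tsum_of_countable hτ h0 f

instance isFiniteMeasureOnCompacts (η : DiscreteRadon d) : IsFiniteMeasureOnCompacts η.1 :=
  ⟨fun {K} hK => η.2.1 K hK⟩

theorem measure_singleton_ne_top (η : DiscreteRadon d) (x : Rd d) : η.1 {x} ≠ ∞ :=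
  (η.2.1 _ isCompact_singleton).ne

theorem countable_setOf_measure_singleton_ne_zero (η : DiscreteRadon d) :
    {x | η.1 {x} ≠ 0}.Countable := by
  obtain ⟨τ, hτ, h0⟩ := η.2.exists_countable
  refine hτ.mono fun x hx => ?_
  by_contra hxτ
  exact hx (measure_mono_null (singleton_subset_iff.2 hxτ) h0)

theorem measurable_apply {A : Set (Rd d)} (hA : MeasurableSet A) :
    Measurable fun η : DiscreteRadon d => η.1 A :=
  (Measure.measurable_coe hA).comp measurable_subtype_coe

theorem measurable_of_apply {α : Type*} [MeasurableSpace α] {F : α → DiscreteRadon d}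
    (h : ∀ A, MeasurableSet A → Measurable fun a => (F a).1 A) : Measurable F := by
  have : Measurable fun a => (F a).1 := Measure.measurable_of_measurable_coe _ h
  exact this.subtype_mk

/-- The identity kernel `η ↦ η` from `𝕂(X)` to `X`. -/
noncomputable def kernel (d : ℕ) : ProbabilityTheory.Kernel (DiscreteRadon d) (Rd d) :=
  ⟨fun η => η.1, measurable_subtype_coe⟩

/-- The shells `{j ≤ ‖x‖ < j + 1}`. -/
def shell (d : ℕ) (j : ℕ) : Set (Rd d) := {x | ⌊‖x‖⌋₊ = j}

theorem measurableSet_shell (j : ℕ) : MeasurableSet (shell d j) :=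
  (Nat.measurable_floor.comp measurable_norm) (measurableSet_singleton j)

theorem measure_shell_lt_top (η : DiscreteRadon d) (j : ℕ) : η.1 (shell d j) < ∞ := by
  refine (measure_mono ?_).trans_lt (η.2.1 _ (isCompact_closedBall (0 : Rd d) (j + 1)))
  intro x hx
  have hx' : ⌊‖x‖⌋₊ = j := hx
  have := Nat.lt_floor_add_one ‖x‖
  rw [hx'] at this
  simpa using this.le

open Classical in
-- The masses of bounded sets are finite but not bounded uniformly in `η`. Cutting space into shells
-- and `𝕂(X)` by the integer part of the mass of the shell yields countably many pieces of bounded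
-- mass.
instance isSFiniteKernel_kernel : ProbabilityTheory.IsSFiniteKernel (kernel d) := by
  have hms : ∀ p : ℕ × ℕ,
      MeasurableSet {η : DiscreteRadon d | ⌊(η.1 (shell d p.1)).toReal⌋₊ = p.2} := fun p =>
    (Nat.measurable_floor.comp (measurable_apply (measurableSet_shell p.1)).ennreal_toReal)
      (measurableSet_singleton p.2)
  let κ : ℕ × ℕ → ProbabilityTheory.Kernel (DiscreteRadon d) (Rd d) := fun p =>
    ProbabilityTheory.Kernel.piecewise (hms p)
      ((kernel d).restrict (measurableSet_shell p.1)) 0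
  have hfin : ∀ p, ProbabilityTheory.IsFiniteKernel (κ p) := by
    refine fun p => ⟨⟨ENNReal.ofReal (p.2 + 1), ENNReal.ofReal_lt_top, fun η => ?_⟩⟩
    simp only [κ, ProbabilityTheory.Kernel.piecewise_apply]
    split_ifs with h
    · rw [ProbabilityTheory.Kernel.restrict_apply, Measure.restrict_apply_univ]
      have h' : ⌊(η.1 (shell d p.1)).toReal⌋₊ = p.2 := h
      have := Nat.lt_floor_add_one (η.1 (shell d p.1)).toReal
      rw [h'] at this
      exact (ENNReal.le_ofReal_iff_toReal_le (measure_shell_lt_top η p.1).ne (by positivity)).2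
        this.le
    · simp
  have hsum : kernel d = ProbabilityTheory.Kernel.sum κ := by
    ext η A hA
    rw [ProbabilityTheory.Kernel.sum_apply' _ _ hA, ENNReal.tsum_prod']
    have h1 : ∀ j, ∑' k, κ (j, k) η A = η.1 (A ∩ shell d j) := by
      intro j
      rw [tsum_eq_single ⌊(η.1 (shell d j)).toReal⌋₊]
      · simp only [κ, ProbabilityTheory.Kernel.piecewise_apply]
        rw [if_pos (by simp), ProbabilityTheory.Kernel.restrict_apply, Measure.restrict_apply hA]
        rfl
      · intro k hk
        simp only [κ, ProbabilityTheory.Kernel.piecewise_apply]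
        rw [if_neg (by simpa using hk.symm)]
        simp
    simp_rw [h1]
    rw [← measure_iUnion]
    · rw [← inter_iUnion]
      have : ⋃ j, shell d j = univ := by
        ext x
        simp [shell]
      rw [this, inter_univ]
      rfl
    · intro i j hij
      refine disjoint_left.2 fun x hx hx' => hij ?_
      exact hx.2.symm.trans hx'.2
    · exact fun j => hA.inter (measurableSet_shell j)
  rw [hsum]
  infer_instance

theorem measurable_lintegral_joint {f : DiscreteRadon d × Rd d → ℝ≥0∞} (hf : Measurable f) :
    Measurable fun η : DiscreteRadon d => ∫⁻ x, f (η, x) ∂η.1 :=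
  Measurable.lintegral_kernel_prod_right' (κ := kernel d) hf

/-- The value is the kernel mass of a section of the diagonal. Joint measurability in `(η, x)` is
what later makes statements about all atoms of a random `η` measurable. -/
theorem measurable_measure_singleton :
    Measurable fun p : DiscreteRadon d × Rd d => p.1.1 {p.2} := by
  have h := ProbabilityTheory.Kernel.measurable_kernel_prodMk_left
    (κ := (kernel d).prodMkRight (Rd d))
    (t := {q : (DiscreteRadon d × Rd d) × Rd d | q.2 = q.1.2})
    (measurableSet_eq_fun measurable_snd measurable_fst.snd)
  exact h

theorem measurable_measure_singleton_right (η : DiscreteRadon d) :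
    Measurable fun x : Rd d => η.1 {x} :=
  measurable_measure_singleton.comp measurable_prodMk_left

theorem measurable_integral {E : Type*} [NormedAddCommGroup E] [NormedSpace ℝ E]
    [MeasurableSpace E] [BorelSpace E] [SecondCountableTopology E] {f : Rd d → E}
    (hf : Measurable f) :
    Measurable fun η : DiscreteRadon d => ∫ x, f x ∂η.1 :=
  (StronglyMeasurable.integral_kernel (κ := kernel d) hf.stronglyMeasurable).measurable

/-! ### Sums and single atoms -/

instance : Zero (DiscreteRadon d) :=
  ⟨⟨0, isDiscreteRadon_of_countable (by simp) countable_empty (by simp)⟩⟩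

@[simp] theorem coe_zero : ((0 : DiscreteRadon d) : Measure (Rd d)) = 0 := rfl

instance : Add (DiscreteRadon d) where
  add η ζ := ⟨η.1 + ζ.1, by
    obtain ⟨τ, hτ, h0⟩ := η.2.exists_countable
    obtain ⟨σ, hσ, h1⟩ := ζ.2.exists_countable
    refine isDiscreteRadon_of_countable (fun K hK => ?_) (hτ.union hσ) ?_
    · exact ENNReal.add_lt_top.2 ⟨η.2.1 K hK, ζ.2.1 K hK⟩
    · rw [Measure.add_apply, compl_union, measure_mono_null inter_subset_left h0,
        measure_mono_null inter_subset_right h1, add_zero]⟩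

@[simp] theorem coe_add (η ζ : DiscreteRadon d) :
    ((η + ζ : DiscreteRadon d) : Measure (Rd d)) = η.1 + ζ.1 := rfl

theorem measurable_add : Measurable fun p : DiscreteRadon d × DiscreteRadon d => p.1 + p.2 :=
  measurable_of_apply fun _ hA =>
    ((measurable_apply hA).comp measurable_fst).add ((measurable_apply hA).comp measurable_snd)

/-- The measure `s δ_x`, zero for `s ≤ 0`. -/
noncomputable def atom (p : Rd d × ℝ) : DiscreteRadon d :=
  ⟨ENNReal.ofReal p.2 • Measure.dirac p.1, isDiscreteRadon_of_countable
    (fun _ _ => ENNReal.mul_lt_top ENNReal.ofReal_lt_top (measure_lt_top _ _))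
    (countable_singleton p.1) (by
      rw [Measure.smul_apply, Measure.dirac_apply' _ (measurableSet_singleton _).compl]
      simp)⟩

theorem coe_atom (p : Rd d × ℝ) :
    (atom p : Measure (Rd d)) = ENNReal.ofReal p.2 • Measure.dirac p.1 := rfl

theorem measurable_atom : Measurable (atom : Rd d × ℝ → DiscreteRadon d) := by
  refine measurable_of_apply fun A hA => ?_
  simp only [coe_atom, Measure.smul_apply, smul_eq_mul, Measure.dirac_apply' _ hA]
  exact measurable_snd.ennreal_ofReal.mul ((measurable_one.indicator hA).comp measurable_fst)

end DiscreteRadon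

open Filter Topology
open DiscreteRadon (atom measurable_atom)

variable {d : ℕ}

/-! ### Uniqueness: the Fourier transform determines the law -/

theorem integrable_of_continuous (η : DiscreteRadon d) {f : Rd d → ℝ} (hf : Continuous f)
    (hc : HasCompactSupport f) : Integrable f η.1 :=
  hf.integrable_of_hasCompactSupport hc

/-- Thickened indicators of `K` are test functions decreasing to its indicator, dominated by the
indicator of one compact neighbourhood. -/
theorem measurable_apply_of_isCompact {α : Type*} [MeasurableSpace α] {G : α → DiscreteRadon d}
    (h : ∀ f : Rd d → ℝ, Continuous f → HasCompactSupport f →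
      Measurable fun a => ∫ x, f x ∂(G a).1)
    {K : Set (Rd d)} (hK : IsCompact K) : Measurable fun a => (G a).1 K := by
  have hpos : ∀ n : ℕ, 0 < 1 / ((n : ℝ) + 1) := fun n => by positivity
  have hlim : Tendsto (fun n : ℕ => 1 / ((n : ℝ) + 1)) atTop (𝓝 0) :=
    tendsto_one_div_add_atTop_nhds_zero_nat
  let f : ℕ → Rd d → ℝ := fun n x => (thickenedIndicator (hpos n) K x : ℝ)
  have hf : ∀ n, Continuous (f n) := fun n =>
    NNReal.continuous_coe.comp (thickenedIndicator (hpos n) K).continuous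
  have hle : ∀ n x, f n x ≤ 1 := fun n x => by
    simpa [f] using NNReal.coe_le_coe.2 (thickenedIndicator_le_one (hpos n) K x)
  have hzero : ∀ n x, x ∉ Metric.thickening 1 K → f n x = 0 := by
    intro n x hx
    have : x ∉ Metric.thickening (1 / ((n : ℝ) + 1)) K := fun h =>
      hx (Metric.thickening_mono (by
        rw [div_le_one (by positivity)]
        exact le_add_of_nonneg_left n.cast_nonneg) K h)
    exact congrArg NNReal.toReal (thickenedIndicator_zero (hpos n) K this)
  have hcpt : IsCompact (closure (Metric.thickening 1 K)) :=
    hK.isBounded.thickening.isCompact_closure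
  have hc : ∀ n, HasCompactSupport (f n) := fun n =>
    HasCompactSupport.intro hcpt fun x hx => hzero n x fun h => hx (subset_closure h)
  have hpt : ∀ x, Tendsto (fun n => f n x) atTop (𝓝 (K.indicator (fun _ => (1 : ℝ)) x)) := by
    intro x
    have := tendsto_pi_nhds.1 (thickenedIndicator_tendsto_indicator_closure hpos hlim K) x
    rw [hK.isClosed.closure_eq] at this
    have h2 := (NNReal.continuous_coe.tendsto _).comp this
    have h3 : ((K.indicator (fun _ => (1 : NNReal)) x : NNReal) : ℝ) =
        K.indicator (fun _ => (1 : ℝ)) x := by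
      by_cases hx : x ∈ K <;> simp [hx]
    rw [← h3]
    exact h2
  have hT : ∀ a, Tendsto (fun n => ∫ x, f n x ∂(G a).1) atTop (𝓝 ((G a).1 K).toReal) := by
    intro a
    have h1 : ((G a).1 K).toReal = ∫ x, K.indicator (fun _ => (1 : ℝ)) x ∂(G a).1 := by
      rw [integral_indicator_const _ hK.measurableSet, smul_eq_mul, mul_one]
      rfl
    rw [h1]
    refine tendsto_integral_of_dominated_convergence
      ((closure (Metric.thickening 1 K)).indicator fun _ => (1 : ℝ))
      (fun n => (hf n).aestronglyMeasurable) ?_ ?_ (ae_of_all _ hpt)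
    · exact (integrable_indicator_iff hcpt.measurableSet).2
        (integrableOn_const ((G a).2.1 _ hcpt).ne)
    · refine fun n => ae_of_all _ fun x => ?_
      by_cases hx : x ∈ closure (Metric.thickening 1 K)
      · rw [indicator_of_mem hx, Real.norm_of_nonneg (NNReal.coe_nonneg _)]
        exact hle n x
      · rw [hzero n x fun h => hx (subset_closure h), norm_zero]
        exact indicator_nonneg (fun _ _ => zero_le_one) _
  have hm : Measurable fun a => ((G a).1 K).toReal :=
    measurable_of_tendsto_metrizable (fun n => h (f n) (hf n) (hc n)) (tendsto_pi_nhds.2 hT)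
  have : (fun a => (G a).1 K) = fun a => ENNReal.ofReal ((G a).1 K).toReal := by
    funext a
    rw [ENNReal.ofReal_toReal ((G a).2.1 K hK).ne]
  rw [this]
  exact hm.ennreal_ofReal

/-- Closed sets form a generating π-system, but the uniqueness argument needs finite measures; hence
the restriction to balls, followed by exhaustion. -/
theorem measurable_of_integral {α : Type*} [MeasurableSpace α] {G : α → DiscreteRadon d}
    (h : ∀ f : Rd d → ℝ, Continuous f → HasCompactSupport f →
      Measurable fun a => ∫ x, f x ∂(G a).1) : Measurable G := by
  have hball : ∀ R : ℕ, IsCompact (Metric.closedBall (0 : Rd d) R) :=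
    fun R => isCompact_closedBall _ _
  have hR : ∀ R : ℕ, Measurable fun a => (G a).1.restrict (Metric.closedBall (0 : Rd d) R) := by
    intro R
    have : ∀ a, IsFiniteMeasure ((G a).1.restrict (Metric.closedBall (0 : Rd d) R)) := fun a =>
      ⟨by rw [Measure.restrict_apply_univ]; exact (G a).2.1 _ (hball R)⟩
    refine Measurable.measure_of_isPiSystem (S := {C : Set (Rd d) | IsClosed C})
      (BorelSpace.measurable_eq.trans borel_eq_generateFrom_isClosed) isPiSystem_isClosed
      (fun C hC => ?_) ?_
    · simp only [Measure.restrict_apply hC.measurableSet]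
      exact measurable_apply_of_isCompact h ((hball R).inter_left hC)
    · simp only [Measure.restrict_apply_univ]
      exact measurable_apply_of_isCompact h (hball R)
  refine DiscreteRadon.measurable_of_apply fun A hA => ?_
  have huniv : ⋃ R : ℕ, Metric.closedBall (0 : Rd d) R = univ :=
    Metric.iUnion_closedBall_nat 0
  have : (fun a => (G a).1 A) =
      fun a => ⨆ R : ℕ, (G a).1.restrict (Metric.closedBall (0 : Rd d) R) A := by
    funext a
    rw [← Measure.restrict_iUnion_apply_eq_iSup _ hA, huniv, Measure.restrict_univ]
    intro i j
    refine ⟨max i j, ?_, ?_⟩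
    · exact Metric.closedBall_subset_closedBall (by simp)
    · exact Metric.closedBall_subset_closedBall (by simp)
  rw [this]
  exact Measurable.iSup fun R => (Measure.measurable_coe hA).comp (hR R)

/-- Continuous real functions with compact support. -/
abbrev TestFunction (d : ℕ) : Type := {f : Rd d → ℝ // Continuous f ∧ HasCompactSupport f}

theorem hasCompactSupport_finsetSum_smul {ι : Type*} (s : Finset ι) (c : ι → ℝ)
    (f : ι → TestFunction d) :
    Continuous (fun x => ∑ i ∈ s, c i * (f i).1 x) ∧
      HasCompactSupport (fun x => ∑ i ∈ s, c i * (f i).1 x) := by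
  classical
  refine ⟨continuous_finsetSum _ fun i _ => continuous_const.mul (f i).2.1, ?_⟩
  induction s using Finset.induction_on with
  | empty =>
    simp only [Finset.sum_empty]
    exact HasCompactSupport.zero
  | insert i s hi ih =>
    simp only [Finset.sum_insert hi]
    exact ((f i).2.2.mul_left (f := fun _ => c i)).add ih

/-- A linear form of finitely many integrals is the integral of a single test function, so the
hypothesis gives the characteristic function of every finite-dimensional marginal of `T`. -/
theorem measure_ext_of_fourier {P Q : Measure (DiscreteRadon d)} [IsProbabilityMeasure P]
    [IsProbabilityMeasure Q]
    (h : ∀ f : Rd d → ℝ, Continuous f → HasCompactSupport f →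
      ∫ η : DiscreteRadon d, Complex.exp (Complex.I * ((∫ x, f x ∂η.1 : ℝ) : ℂ)) ∂P =
      ∫ η : DiscreteRadon d, Complex.exp (Complex.I * ((∫ x, f x ∂η.1 : ℝ) : ℂ)) ∂Q) : P = Q := by
  let T : DiscreteRadon d → TestFunction d → ℝ := fun η f => ∫ x, f.1 x ∂η.1
  have hT : Measurable T := measurable_pi_lambda _ fun f =>
    DiscreteRadon.measurable_integral f.2.1.measurable
  have hfin : ∀ I : Finset (TestFunction d), (P.map T).map I.restrict = (Q.map T).map I.restrict := by
    intro I
    rw [Measure.map_map (Finset.measurable_restrict I) hT,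
      Measure.map_map (Finset.measurable_restrict I) hT]
    have hm : Measurable (I.restrict ∘ T) := (Finset.measurable_restrict I).comp hT
    have := Measure.isProbabilityMeasure_map (μ := P) hm.aemeasurable
    have := Measure.isProbabilityMeasure_map (μ := Q) hm.aemeasurable
    refine Measure.ext_of_charFunDual (funext fun L => ?_)
    have hexp : AEStronglyMeasurable (fun v : I → ℝ => Complex.exp (L v * Complex.I))
        (P.map (I.restrict ∘ T)) := by fun_prop
    have hexp' : AEStronglyMeasurable (fun v : I → ℝ => Complex.exp (L v * Complex.I))
        (Q.map (I.restrict ∘ T)) := by fun_prop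
    rw [charFunDual_apply, charFunDual_apply, integral_map hm.aemeasurable hexp,
      integral_map hm.aemeasurable hexp']
    classical
    obtain ⟨hc, hs⟩ := hasCompactSupport_finsetSum_smul Finset.univ
      (fun i : I => L (Pi.single i 1)) (fun i => i.1)
    have key : ∀ η : DiscreteRadon d, L ((I.restrict ∘ T) η) =
        ∫ x, ∑ i : I, L (Pi.single i 1) * i.1.1 x ∂η.1 := by
      intro η
      rw [integral_finsetSum _ fun i _ => (integrable_of_continuous η i.1.2.1 i.1.2.2).const_mul _]
      simp_rw [integral_const_mul]
      have : (I.restrict ∘ T) η = ∑ i : I, ((I.restrict ∘ T) η i) • Pi.single i (1 : ℝ) := by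
        funext j
        simp [Finset.sum_apply, Pi.single_apply]
      rw [this, map_sum]
      refine Finset.sum_congr rfl fun i _ => ?_
      rw [map_smul, smul_eq_mul, mul_comm]
      rfl
    have := h _ hc hs
    simp only [key, mul_comm _ Complex.I]
    exact this
  have hPQ : P.map T = Q.map T := by
    have := Measure.isProbabilityMeasure_map (μ := P) hT.aemeasurable
    have := Measure.isProbabilityMeasure_map (μ := Q) hT.aemeasurable
    have hI : ∀ I : Finset (TestFunction d), IsFiniteMeasure ((Q.map T).map I.restrict) :=
      fun I => inferInstance
    exact IsProjectiveLimit.unique (P := fun I => (Q.map T).map I.restrict) hfin fun I => rfl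
  -- `T` generates the whole σ-algebra: the identity is measurable from the σ-algebra pulled back
  -- along `T`.
  have hle : (inferInstance : MeasurableSpace (DiscreteRadon d)) ≤
      MeasurableSpace.comap T inferInstance := by
    have : @Measurable _ _ (MeasurableSpace.comap T inferInstance) _
        (id : DiscreteRadon d → DiscreteRadon d) := by
      refine @measurable_of_integral d _ (MeasurableSpace.comap T inferInstance) id ?_
      intro f hf hfc
      exact (measurable_pi_apply (⟨f, hf, hfc⟩ : TestFunction d)).comp (comap_measurable T)
    exact fun A hA => this hA
  ext A hA
  obtain ⟨B, hB, rfl⟩ := hle A hA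
  rw [← Measure.map_apply hT hB, ← Measure.map_apply hT hB, hPQ]

/-! ### Completely random measures with finite Lévy measure -/

/-- A bounded measurable multiplicative functional on `𝕂(X)`. -/
structure IsMultiplicative (Φ : DiscreteRadon d → ℂ) : Prop where
  measurable : Measurable Φ
  norm_le : ∀ η, ‖Φ η‖ ≤ 1
  map_zero : Φ 0 = 1
  map_add : ∀ η ζ, Φ (η + ζ) = Φ η * Φ ζ

theorem IsMultiplicative.integrable {Φ : DiscreteRadon d → ℂ} (hΦ : IsMultiplicative Φ)
    (P : Measure (DiscreteRadon d)) [IsFiniteMeasure P] : Integrable Φ P :=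
  Integrable.of_bound hΦ.measurable.aestronglyMeasurable 1 (ae_of_all _ hΦ.norm_le)

/-- The image of the `k`-th product power of `ν` under `(x₁, s₁, …, x_k, s_k) ↦ ∑ sᵢ δ_{xᵢ}`. -/
noncomputable def convPow (ν : Measure (Rd d × ℝ)) : ℕ → Measure (DiscreteRadon d)
  | 0 => Measure.dirac 0
  | k + 1 => (ν.prod (convPow ν k)).map fun p => atom p.1 + p.2

theorem measurable_atom_add :
    Measurable fun p : (Rd d × ℝ) × DiscreteRadon d => atom p.1 + p.2 :=
  DiscreteRadon.measurable_add.comp ((measurable_atom.comp measurable_fst).prodMk measurable_snd)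

instance isFiniteMeasure_convPow (ν : Measure (Rd d × ℝ)) [IsFiniteMeasure ν] (k : ℕ) :
    IsFiniteMeasure (convPow ν k) := by
  induction k with
  | zero => rw [convPow]; infer_instance
  | succ k ih => rw [convPow]; infer_instance

theorem convPow_univ (ν : Measure (Rd d × ℝ)) [IsFiniteMeasure ν] (k : ℕ) :
    convPow ν k univ = ν univ ^ k := by
  induction k with
  | zero => simp [convPow]
  | succ k ih =>
    rw [convPow, Measure.map_apply measurable_atom_add MeasurableSet.univ, preimage_univ,
      ← univ_prod_univ, Measure.prod_prod, ih, pow_succ, mul_comm]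

theorem integral_convPow (ν : Measure (Rd d × ℝ)) [IsFiniteMeasure ν] {Φ : DiscreteRadon d → ℂ}
    (hΦ : IsMultiplicative Φ) (k : ℕ) :
    ∫ η, Φ η ∂(convPow ν k) = (∫ p, Φ (atom p) ∂ν) ^ k := by
  induction k with
  | zero =>
    rw [convPow, integral_dirac' _ _ hΦ.measurable.stronglyMeasurable, hΦ.map_zero, pow_zero]
  | succ k ih =>
    rw [convPow, integral_map measurable_atom_add.aemeasurable
      hΦ.measurable.aestronglyMeasurable]
    simp_rw [hΦ.map_add]
    rw [integral_prod_mul (fun p => Φ (atom p)) Φ, ih, pow_succ, mul_comm]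

/-- Absolute continuity passes through products and images; this is the only place where it is
transferred from Lévy measures to random measures. -/
theorem convPow_absolutelyContinuous {ν ν' : Measure (Rd d × ℝ)} [IsFiniteMeasure ν]
    [IsFiniteMeasure ν'] (h : ν' ≪ ν) (k : ℕ) : convPow ν' k ≪ convPow ν k := by
  induction k with
  | zero => exact Measure.AbsolutelyContinuous.rfl
  | succ k ih => exact (h.prod ih).map measurable_atom_add

/-- The law of the completely random measure with finite Lévy measure `ν`. -/
noncomputable def finiteLaw (ν : Measure (Rd d × ℝ)) : Measure (DiscreteRadon d) :=
  ENNReal.ofReal (Real.exp (-ν.real univ)) •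
    Measure.sum fun k : ℕ => ENNReal.ofReal ((k.factorial : ℝ)⁻¹) • convPow ν k

instance isProbabilityMeasure_finiteLaw (ν : Measure (Rd d × ℝ)) [IsFiniteMeasure ν] :
    IsProbabilityMeasure (finiteLaw ν) := by
  refine ⟨?_⟩
  have h1 : ∀ k : ℕ, (ENNReal.ofReal ((k.factorial : ℝ)⁻¹) • convPow ν k) univ =
      ENNReal.ofReal ((ν.real univ) ^ k / k.factorial) := by
    intro k
    rw [Measure.smul_apply, convPow_univ, smul_eq_mul, div_eq_inv_mul,
      ENNReal.ofReal_mul (by positivity), ENNReal.ofReal_pow measureReal_nonneg,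
      ofReal_measureReal]
  have h2 : HasSum (fun k : ℕ => (ν.real univ) ^ k / k.factorial) (Real.exp (ν.real univ)) := by
    rw [Real.exp_eq_exp_ℝ]
    exact NormedSpace.expSeries_div_hasSum_exp _
  rw [finiteLaw, Measure.smul_apply, Measure.sum_apply _ MeasurableSet.univ]
  simp_rw [h1]
  rw [← ENNReal.ofReal_tsum_of_nonneg (fun k => by positivity) h2.summable, h2.tsum_eq,
    smul_eq_mul, ← ENNReal.ofReal_mul (Real.exp_pos _).le, ← Real.exp_add]
  simp

theorem ae_finiteLaw {ν : Measure (Rd d × ℝ)} {p : DiscreteRadon d → Prop}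
    (h : ∀ k, ∀ᵐ η ∂(convPow ν k), p η) : ∀ᵐ η ∂(finiteLaw ν), p η := by
  refine Measure.ae_smul_measure ?_ _
  exact Measure.ae_sum_iff.2 fun k => Measure.ae_smul_measure (h k) _

/-- Multiplicativity turns the `k`-th term into `(∫ Φ(atom) dν)^k / k!`; the normalising factor
`exp(-ν(univ))` supplies the `-1` in the exponent. -/
theorem integral_finiteLaw (ν : Measure (Rd d × ℝ)) [IsFiniteMeasure ν] {Φ : DiscreteRadon d → ℂ}
    (hΦ : IsMultiplicative Φ) :
    ∫ η, Φ η ∂(finiteLaw ν) = Complex.exp (∫ p, (Φ (atom p) - 1) ∂ν) := by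
  have hfin : IsFiniteMeasure
      (Measure.sum fun k : ℕ => ENNReal.ofReal ((k.factorial : ℝ)⁻¹) • convPow ν k) := by
    -- Infinite mass of the unnormalised series would contradict the total mass `1` of `finiteLaw
    -- ν`.
    refine ⟨lt_top_iff_ne_top.2 fun htop => ?_⟩
    have h := measure_univ (μ := finiteLaw ν)
    rw [finiteLaw, Measure.smul_apply, htop, smul_eq_mul, ENNReal.mul_top] at h
    · exact ENNReal.top_ne_one h
    · exact (ENNReal.ofReal_pos.2 (Real.exp_pos _)).ne'
  have h1 := hasSum_integral_measure (hΦ.integrable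
    (Measure.sum fun k : ℕ => ENNReal.ofReal ((k.factorial : ℝ)⁻¹) • convPow ν k))
  have h2 : HasSum (fun k : ℕ => (∫ p, Φ (atom p) ∂ν) ^ k / k.factorial)
      (Complex.exp (∫ p, Φ (atom p) ∂ν)) := by
    rw [Complex.exp_eq_exp_ℂ]
    exact NormedSpace.expSeries_div_hasSum_exp _
  have h3 : (fun k : ℕ => ∫ η, Φ η ∂(ENNReal.ofReal ((k.factorial : ℝ)⁻¹) • convPow ν k)) =
      fun k : ℕ => (∫ p, Φ (atom p) ∂ν) ^ k / k.factorial := by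
    funext k
    rw [integral_smul_measure, integral_convPow ν hΦ, ENNReal.toReal_ofReal (by positivity),
      Complex.real_smul, div_eq_inv_mul]
    push_cast
    rfl
  rw [h3] at h1
  have hint : Integrable (fun p => Φ (atom p)) ν :=
    Integrable.of_bound (hΦ.measurable.comp measurable_atom).aestronglyMeasurable 1
      (ae_of_all _ fun p => hΦ.norm_le _)
  rw [finiteLaw, integral_smul_measure, h1.unique h2, ENNReal.toReal_ofReal (Real.exp_pos _).le,
    Complex.real_smul, Complex.ofReal_exp, ← Complex.exp_add,
    integral_sub hint (integrable_const _), integral_const]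
  congr 1
  simp
  ring

/-- All weights of the series are positive, so a null set is null for every convolution power. -/
theorem finiteLaw_absolutelyContinuous {ν ν' : Measure (Rd d × ℝ)} [IsFiniteMeasure ν]
    [IsFiniteMeasure ν'] (h : ν' ≪ ν) : finiteLaw ν' ≪ finiteLaw ν := by
  intro A hA
  rw [finiteLaw, Measure.smul_apply, smul_eq_mul, mul_eq_zero] at hA
  have hA' := hA.resolve_left (ENNReal.ofReal_pos.2 (Real.exp_pos _)).ne'
  rw [Measure.sum_apply_eq_zero] at hA'
  rw [finiteLaw, Measure.smul_apply, Measure.sum_apply_eq_zero.2, smul_zero]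
  intro k
  have hk := hA' k
  rw [Measure.smul_apply, smul_eq_mul, mul_eq_zero] at hk
  have hk' := hk.resolve_left (ENNReal.ofReal_pos.2 (by positivity)).ne'
  rw [Measure.smul_apply, convPow_absolutelyContinuous h k hk', smul_zero]

/-! ### Atoms of completely random measures with finite Lévy measure -/

theorem measurableSet_measure_singleton_eq_zero (x : Rd d) :
    MeasurableSet {η : DiscreteRadon d | η.1 {x} = 0} :=
  DiscreteRadon.measurable_apply (measurableSet_singleton x) (measurableSet_singleton 0)

theorem atom_apply_singleton_of_ne (p : Rd d × ℝ) {x : Rd d} (h : p.1 ≠ x) :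
    (atom p).1 {x} = 0 := by
  rw [DiscreteRadon.coe_atom, Measure.smul_apply,
    Measure.dirac_apply' _ (measurableSet_singleton x),
    indicator_of_notMem (show p.1 ∉ ({x} : Set (Rd d)) from h), smul_zero]

theorem atom_apply_singleton_self (p : Rd d × ℝ) :
    (atom p).1 {p.1} = ENNReal.ofReal p.2 := by
  rw [DiscreteRadon.coe_atom, Measure.smul_apply,
    Measure.dirac_apply' _ (measurableSet_singleton _),
    indicator_of_mem (mem_singleton p.1), Pi.one_apply, smul_eq_mul, mul_one]

theorem ae_convPow_measure_singleton {ν : Measure (Rd d × ℝ)} [IsFiniteMeasure ν] {x : Rd d}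
    (hx : ν ({x} ×ˢ univ) = 0) (k : ℕ) : ∀ᵐ η ∂(convPow ν k), η.1 {x} = 0 := by
  induction k with
  | zero =>
    rw [convPow, ae_dirac_iff (measurableSet_measure_singleton_eq_zero x)]
    rfl
  | succ k ih =>
    rw [convPow, ae_map_iff measurable_atom_add.aemeasurable
      (measurableSet_measure_singleton_eq_zero x)]
    have h1 : ∀ᵐ p ∂ν, p.1 ≠ x := by
      rw [ae_iff]
      refine measure_mono_null (fun p hp => ?_) hx
      simpa using hp
    filter_upwards [Measure.quasiMeasurePreserving_fst.ae h1,
      Measure.quasiMeasurePreserving_snd.ae ih] with p hp1 hp2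
    rw [DiscreteRadon.coe_add, Measure.add_apply, atom_apply_singleton_of_ne _ hp1, hp2, add_zero]

/-- The uncountable quantifier is replaced by one integral: points of zero mass never violate the
bound, so no atom exceeds `c` iff `η` gives no mass to such points. -/
theorem measurableSet_forall_measure_singleton_le (c : ℝ≥0∞) :
    MeasurableSet {η : DiscreteRadon d | ∀ x, η.1 {x} ≤ c} := by
  have hm : MeasurableSet {p : DiscreteRadon d × Rd d | c < p.1.1 {p.2}} :=
    DiscreteRadon.measurable_measure_singleton measurableSet_Ioi
  have h1 := DiscreteRadon.measurable_lintegral_joint (measurable_one.indicator hm)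
  have h2 : {η : DiscreteRadon d | ∀ x, η.1 {x} ≤ c} = {η : DiscreteRadon d |
      ∫⁻ x, {p : DiscreteRadon d × Rd d | c < p.1.1 {p.2}}.indicator 1 (η, x) ∂η.1 = 0} := by
    ext η
    rw [mem_ofPred_eq, mem_ofPred_eq, DiscreteRadon.lintegral_eq_tsum, ENNReal.tsum_eq_zero]
    refine forall_congr' fun x => ?_
    by_cases hx : c < η.1 {x}
    · rw [indicator_of_mem (by exact hx)]
      simp [hx.not_ge, (pos_of_gt hx).ne']
    · rw [indicator_of_notMem (by exact hx)]
      simpa using hx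
  rw [h2]
  exact h1 (measurableSet_singleton 0)

theorem ae_measure_setOf_singleton_ne_zero {ν : Measure (Rd d × ℝ)}
    (hν : ∀ x : Rd d, ν ({x} ×ˢ univ) = 0) (η : DiscreteRadon d) :
    ∀ᵐ p ∂ν, η.1 {p.1} = 0 := by
  have hc := η.countable_setOf_measure_singleton_ne_zero
  rw [ae_iff]
  refine measure_mono_null (t := ⋃ x ∈ {x | η.1 {x} ≠ 0}, {x} ×ˢ univ) (fun p hp => ?_) ?_
  · exact mem_biUnion (show p.1 ∈ {x | η.1 {x} ≠ 0} from hp) ⟨rfl, mem_univ _⟩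
  · exact (measure_biUnion_null_iff hc).2 fun x _ => hν x

/-- The weights of two atoms never add up: the earlier atoms are countably many and `ν` does not
charge the fibre over a point, so the new atom almost surely sits elsewhere. -/
theorem ae_convPow_forall_measure_singleton_le {ν : Measure (Rd d × ℝ)} [IsFiniteMeasure ν]
    (hν : ∀ x : Rd d, ν ({x} ×ˢ univ) = 0) {c : ℝ} (hc : ∀ᵐ p ∂ν, p.2 ≤ c) (k : ℕ) :
    ∀ᵐ η ∂(convPow ν k), ∀ x, η.1 {x} ≤ ENNReal.ofReal c := by
  induction k with
  | zero =>
    rw [convPow, ae_dirac_iff (measurableSet_forall_measure_singleton_le _)]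
    intro x
    simp
  | succ k ih =>
    rw [convPow, ae_map_iff measurable_atom_add.aemeasurable
      (measurableSet_forall_measure_singleton_le _)]
    have h1 : ∀ᵐ p ∂(ν.prod (convPow ν k)), p.2.1 {p.1.1} = 0 := by
      have hm : MeasurableSet {p : (Rd d × ℝ) × DiscreteRadon d | p.2.1 {p.1.1} = 0} :=
        (DiscreteRadon.measurable_measure_singleton.comp
          (measurable_snd.prodMk measurable_fst.fst)) (measurableSet_singleton 0)
      rw [Measure.ae_prod_iff_ae_ae hm]
      refine (Measure.ae_ae_comm hm).2 ?_
      exact ae_of_all _ fun η => ae_measure_setOf_singleton_ne_zero hν η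
    filter_upwards [h1, Measure.quasiMeasurePreserving_fst.ae hc,
      Measure.quasiMeasurePreserving_snd.ae ih] with p hp1 hp2 hp3 x
    rw [DiscreteRadon.coe_add, Measure.add_apply]
    by_cases hx : p.1.1 = x
    · subst hx
      rw [hp1, add_zero, atom_apply_singleton_self]
      exact ENNReal.ofReal_le_ofReal hp2
    · rw [atom_apply_singleton_of_ne _ hx, zero_add]
      exact hp3 x

/-! ### Fourier and Laplace functionals -/

/-- The functional `η ↦ exp(i⟨f, η⟩)`. -/
noncomputable def fourierFun (f : Rd d → ℝ) (η : DiscreteRadon d) : ℂ :=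
  Complex.exp (Complex.I * ((∫ x, f x ∂η.1 : ℝ) : ℂ))

theorem isMultiplicative_fourierFun {f : Rd d → ℝ} (hf : Continuous f)
    (hc : HasCompactSupport f) : IsMultiplicative (fourierFun f) where
  measurable := Complex.measurable_exp.comp (measurable_const.mul
    (Complex.measurable_ofReal.comp (DiscreteRadon.measurable_integral hf.measurable)))
  norm_le η := by
    rw [fourierFun, mul_comm, Complex.norm_exp_ofReal_mul_I]
  map_zero := by simp [fourierFun]
  map_add η ζ := by
    rw [fourierFun, fourierFun, fourierFun, ← Complex.exp_add, ← mul_add, ← Complex.ofReal_add,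
      DiscreteRadon.coe_add, integral_add_measure (integrable_of_continuous η hf hc)
        (integrable_of_continuous ζ hf hc)]

theorem fourierFun_atom (f : Rd d → ℝ) {p : Rd d × ℝ} (hp : 0 < p.2) :
    fourierFun f (atom p) = Complex.exp (Complex.I * ((p.2 * f p.1 : ℝ) : ℂ)) := by
  rw [fourierFun, DiscreteRadon.coe_atom, integral_smul_measure, integral_dirac,
    ENNReal.toReal_ofReal hp.le, smul_eq_mul]

/-- Unlike the Fourier functional, this one tends to `0` as the mass of `A` grows, so it detects
explosion of a series. -/
theorem isMultiplicative_laplace {A : Set (Rd d)} (hA : MeasurableSet A)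
    (hfin : ∀ η : DiscreteRadon d, η.1 A ≠ ∞) {t : ℝ} (ht : 0 ≤ t) :
    IsMultiplicative fun η : DiscreteRadon d =>
      ((Real.exp (-(t * (η.1 A).toReal)) : ℝ) : ℂ) where
  measurable := Complex.measurable_ofReal.comp (Real.measurable_exp.comp
    (measurable_const.mul (DiscreteRadon.measurable_apply hA).ennreal_toReal).neg)
  norm_le η := by
    rw [Complex.norm_real, Real.norm_of_nonneg (Real.exp_pos _).le, Real.exp_le_one_iff]
    have := mul_nonneg ht (ENNReal.toReal_nonneg (a := η.1 A))
    linarith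
  map_zero := by simp
  map_add η ζ := by
    rw [DiscreteRadon.coe_add, Measure.add_apply, ENNReal.toReal_add (hfin η) (hfin ζ),
      ← Complex.ofReal_mul, ← Real.exp_add]
    congr 2
    ring

/-! ### Independent sums -/

/-- The sum of the first `J` terms of a sequence in `𝕂(X)`. -/
noncomputable def partialSum : ℕ → (ℕ → DiscreteRadon d) → DiscreteRadon d
  | 0, _ => 0
  | J + 1, ω => partialSum J ω + ω J

theorem measurable_partialSum (J : ℕ) :
    Measurable (partialSum J : (ℕ → DiscreteRadon d) → DiscreteRadon d) := by
  induction J with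
  | zero => exact measurable_const
  | succ J ih => exact DiscreteRadon.measurable_add.comp (ih.prodMk (measurable_pi_apply J))

theorem coe_partialSum (J : ℕ) (ω : ℕ → DiscreteRadon d) :
    (partialSum J ω).1 = ∑ j ∈ Finset.range J, (ω j).1 := by
  induction J with
  | zero => rfl
  | succ J ih => rw [partialSum, DiscreteRadon.coe_add, ih, Finset.sum_range_succ]

theorem IsMultiplicative.map_partialSum {Φ : DiscreteRadon d → ℂ} (hΦ : IsMultiplicative Φ)
    (J : ℕ) (ω : ℕ → DiscreteRadon d) :
    Φ (partialSum J ω) = ∏ j ∈ Finset.range J, Φ (ω j) := by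
  induction J with
  | zero => exact hΦ.map_zero
  | succ J ih => rw [partialSum, hΦ.map_add, ih, Finset.prod_range_succ]

/-- The joint law of independent completely random measures with Lévy measures `ν j`. -/
noncomputable def jointLaw (ν : ℕ → Measure (Rd d × ℝ)) [∀ j, IsFiniteMeasure (ν j)] :
    Measure (ℕ → DiscreteRadon d) :=
  Measure.infinitePi fun j => finiteLaw (ν j)

instance isProbabilityMeasure_jointLaw (ν : ℕ → Measure (Rd d × ℝ)) [∀ j, IsFiniteMeasure (ν j)] :
    IsProbabilityMeasure (jointLaw ν) := by
  rw [jointLaw]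
  infer_instance

theorem integral_jointLaw_partialSum (ν : ℕ → Measure (Rd d × ℝ)) [∀ j, IsFiniteMeasure (ν j)]
    {Φ : DiscreteRadon d → ℂ} (hΦ : IsMultiplicative Φ) (J : ℕ) :
    ∫ ω, Φ (partialSum J ω) ∂(jointLaw ν) =
      Complex.exp (∑ j ∈ Finset.range J, ∫ p, (Φ (atom p) - 1) ∂(ν j)) := by
  have h1 : ∀ ω : ℕ → DiscreteRadon d, Φ (partialSum J ω) =
      (fun y : (i : Finset.range J) → DiscreteRadon d => ∏ i, Φ (y i))
        ((Finset.range J).restrict ω) := by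
    intro ω
    rw [hΦ.map_partialSum]
    exact (Finset.prod_coe_sort (Finset.range J) fun j => Φ (ω j)).symm
  have hm : Measurable fun y : (i : Finset.range J) → DiscreteRadon d => ∏ i, Φ (y i) :=
    Finset.measurable_prod _ fun i _ => hΦ.measurable.comp (measurable_pi_apply i)
  have h2 := integral_restrict_infinitePi (μ := fun j => finiteLaw (ν j)) (s := Finset.range J)
    (f := fun y : (i : Finset.range J) → DiscreteRadon d => ∏ i, Φ (y i))
    hm.aestronglyMeasurable
  rw [integral_congr_ae (ae_of_all _ h1), jointLaw]
  refine h2.trans ?_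
  rw [integral_fintype_prod_eq_prod fun (_ : Finset.range J) η => Φ η]
  simp_rw [integral_finiteLaw _ hΦ]
  rw [Complex.exp_sum]
  exact Finset.prod_coe_sort (Finset.range J) fun j =>
    Complex.exp (∫ p, (Φ (atom p) - 1) ∂(ν j))

theorem integrable_atom_sub_one {Φ : DiscreteRadon d → ℂ} (hΦ : IsMultiplicative Φ)
    (ν : Measure (Rd d × ℝ)) [IsFiniteMeasure ν] : Integrable (fun p => Φ (atom p) - 1) ν :=
  (Integrable.of_bound (hΦ.measurable.comp measurable_atom).aestronglyMeasurable 1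
    (ae_of_all _ fun _ => hΦ.norm_le _)).sub (integrable_const _)

/-- Exponents of independent summands add up, so both laws have the same Fourier transform. -/
theorem map_partialSum_jointLaw (ν : ℕ → Measure (Rd d × ℝ)) [∀ j, IsFiniteMeasure (ν j)]
    (J : ℕ) : (jointLaw ν).map (partialSum J) = finiteLaw (∑ j ∈ Finset.range J, ν j) := by
  have := Measure.isProbabilityMeasure_map (μ := jointLaw ν)
    (measurable_partialSum J).aemeasurable
  refine measure_ext_of_fourier fun f hf hc => ?_
  have hΦ := isMultiplicative_fourierFun hf hc
  have h1 := integral_jointLaw_partialSum ν hΦ J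
  rw [← integral_map (measurable_partialSum J).aemeasurable
    hΦ.measurable.aestronglyMeasurable] at h1
  have h2 := integral_finiteLaw (∑ j ∈ Finset.range J, ν j) hΦ
  rw [integral_finsetSum_measure fun j _ => integrable_atom_sub_one hΦ (ν j)] at h2
  exact h1.trans h2.symm

theorem finsetSum_le_sum (ν : ℕ → Measure (Rd d × ℝ)) (J : ℕ) :
    ∑ j ∈ Finset.range J, ν j ≤ Measure.sum ν := by
  refine Measure.le_iff.2 fun A hA => ?_
  rw [Measure.finsetSum_apply, Measure.sum_apply _ hA]
  exact ENNReal.sum_le_tsum _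

/-- On the explosion event `1 - exp(-t S_J) → 1`, where `S_J` is the mass that the partial sum gives
to `A`, so Fatou bounds its probability by expectations over partial sums. The bound is uniform in
`J` and will be used as `t → 0`. -/
theorem measure_sum_eq_top_le (ν : ℕ → Measure (Rd d × ℝ)) [∀ j, IsFiniteMeasure (ν j)]
    {A : Set (Rd d)} (hA : MeasurableSet A) (hfin : ∀ η : DiscreteRadon d, η.1 A ≠ ∞)
    {t : ℝ} (ht : 0 < t) :
    jointLaw ν {ω | Measure.sum (fun j => (ω j).1) A = ∞} ≤
      ∫⁻ p in A ×ˢ univ, ENNReal.ofReal (min 1 (t * p.2)) ∂(Measure.sum ν) := by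
  have hΦ := isMultiplicative_laplace hA hfin ht.le
  have hmeas : Measurable fun η : DiscreteRadon d => Real.exp (-(t * (η.1 A).toReal)) :=
    Real.measurable_exp.comp
      (measurable_const.mul (DiscreteRadon.measurable_apply hA).ennreal_toReal).neg
  have hle1 : ∀ η : DiscreteRadon d, Real.exp (-(t * (η.1 A).toReal)) ≤ 1 := fun η => by
    rw [Real.exp_le_one_iff]
    have := mul_nonneg ht.le (ENNReal.toReal_nonneg (a := η.1 A))
    linarith
  have hJ : ∀ J, ∫⁻ ω, ENNReal.ofReal (1 - Real.exp (-(t * ((partialSum J ω).1 A).toReal)))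
      ∂(jointLaw ν) ≤
      ∫⁻ p in A ×ˢ univ, ENNReal.ofReal (min 1 (t * p.2)) ∂(Measure.sum ν) := by
    intro J
    set νJ := ∑ j ∈ Finset.range J, ν j with hνJ
    have hint : Integrable (fun η : DiscreteRadon d => Real.exp (-(t * (η.1 A).toReal)))
        (finiteLaw νJ) := Integrable.of_bound hmeas.aestronglyMeasurable 1
          (ae_of_all _ fun η => by
            rw [Real.norm_of_nonneg (Real.exp_pos _).le]
            exact hle1 η)
    have hinta : Integrable (fun p : Rd d × ℝ => 1 - Real.exp (-(t * ((atom p).1 A).toReal)))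
        νJ := (integrable_const _).sub (Integrable.of_bound
          (hmeas.comp measurable_atom).aestronglyMeasurable 1
          (ae_of_all _ fun p => by
            rw [Real.norm_of_nonneg (Real.exp_pos _).le]
            exact hle1 _))
    have h1 : ∫ η, Real.exp (-(t * (η.1 A).toReal)) ∂(finiteLaw νJ) =
        Real.exp (-∫ p, (1 - Real.exp (-(t * ((atom p).1 A).toReal))) ∂νJ) := by
      have h2 := integral_finiteLaw νJ hΦ
      have h3 : (fun p : Rd d × ℝ =>
          ((Real.exp (-(t * ((atom p).1 A).toReal)) : ℝ) : ℂ) - 1) =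
          fun p => (((-(1 - Real.exp (-(t * ((atom p).1 A).toReal)))) : ℝ) : ℂ) := by
        funext p
        push_cast
        ring
      rw [h3, integral_complex_ofReal, integral_complex_ofReal, ← Complex.ofReal_exp,
        integral_neg] at h2
      exact Complex.ofReal_injective h2
    calc ∫⁻ ω, ENNReal.ofReal (1 - Real.exp (-(t * ((partialSum J ω).1 A).toReal))) ∂(jointLaw ν)
        = ∫⁻ η, ENNReal.ofReal (1 - Real.exp (-(t * (η.1 A).toReal))) ∂(finiteLaw νJ) := by
          rw [hνJ, ← map_partialSum_jointLaw,
            lintegral_map (Measurable.ennreal_ofReal (by fun_prop)) (measurable_partialSum J)]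
      _ = ENNReal.ofReal (∫ η, (1 - Real.exp (-(t * (η.1 A).toReal))) ∂(finiteLaw νJ)) :=
          (ofReal_integral_eq_lintegral_ofReal ((integrable_const _).sub hint)
            (ae_of_all _ fun η => sub_nonneg.2 (hle1 η))).symm
      -- By `h1` the left side is `1 - exp(-a)` with `a` the integral on the right, and `1 - exp(-a)
      -- ≤ a`.
      _ ≤ ENNReal.ofReal (∫ p, (1 - Real.exp (-(t * ((atom p).1 A).toReal))) ∂νJ) := by
          refine ENNReal.ofReal_le_ofReal ?_
          rw [integral_sub (integrable_const _) hint, h1]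
          have := Real.add_one_le_exp (-∫ p, (1 - Real.exp (-(t * ((atom p).1 A).toReal))) ∂νJ)
          simp only [integral_const, probReal_univ, smul_eq_mul, mul_one]
          linarith
      _ = ∫⁻ p, ENNReal.ofReal (1 - Real.exp (-(t * ((atom p).1 A).toReal))) ∂νJ :=
          ofReal_integral_eq_lintegral_ofReal hinta
            (ae_of_all _ fun p => sub_nonneg.2 (hle1 _))
      _ ≤ ∫⁻ p, (A ×ˢ univ).indicator (fun p => ENNReal.ofReal (min 1 (t * p.2))) p ∂νJ := by
          refine lintegral_mono fun p => ?_
          rw [DiscreteRadon.coe_atom, Measure.smul_apply, Measure.dirac_apply' _ hA]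
          by_cases hp : p.1 ∈ A
          · rw [indicator_of_mem hp, indicator_of_mem (show p ∈ A ×ˢ univ from ⟨hp, mem_univ _⟩),
              Pi.one_apply, smul_eq_mul, mul_one]
            rcases le_or_gt p.2 0 with h0 | h0
            · simp [ENNReal.ofReal_of_nonpos h0]
            · rw [ENNReal.toReal_ofReal h0.le]
              refine ENNReal.ofReal_le_ofReal (le_min ?_ ?_)
              · linarith [Real.exp_pos (-(t * p.2))]
              · linarith [Real.add_one_le_exp (-(t * p.2))]
          · rw [indicator_of_notMem hp]
            simp
      _ = ∫⁻ p in A ×ˢ univ, ENNReal.ofReal (min 1 (t * p.2)) ∂νJ :=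
          lintegral_indicator (hA.prod MeasurableSet.univ) _
      _ ≤ _ := lintegral_mono' (Measure.restrict_mono le_rfl (finsetSum_le_sum ν J)) le_rfl
  have hmJ : ∀ J, Measurable fun ω : ℕ → DiscreteRadon d =>
      ENNReal.ofReal (1 - Real.exp (-(t * ((partialSum J ω).1 A).toReal))) := fun J =>
    (measurable_const.sub (hmeas.comp (measurable_partialSum J))).ennreal_ofReal
  have hmtop : MeasurableSet
      {ω : ℕ → DiscreteRadon d | Measure.sum (fun j => (ω j).1) A = ∞} := by
    simp only [Measure.sum_apply _ hA]
    exact (Measurable.tsum fun j =>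
      (DiscreteRadon.measurable_apply hA).comp (measurable_pi_apply j)) (measurableSet_singleton ∞)
  calc jointLaw ν {ω | Measure.sum (fun j => (ω j).1) A = ∞}
      = ∫⁻ ω, {ω | Measure.sum (fun j => (ω j).1) A = ∞}.indicator 1 ω ∂(jointLaw ν) :=
        (lintegral_indicator_one hmtop).symm
    _ ≤ ∫⁻ ω, liminf (fun J =>
          ENNReal.ofReal (1 - Real.exp (-(t * ((partialSum J ω).1 A).toReal)))) atTop
          ∂(jointLaw ν) := by
        refine lintegral_mono fun ω => ?_
        by_cases hω : ω ∈ {ω : ℕ → DiscreteRadon d | Measure.sum (fun j => (ω j).1) A = ∞}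
        · rw [indicator_of_mem hω, Pi.one_apply]
          have hω' : Measure.sum (fun j => (ω j).1) A = ∞ := hω
          rw [Measure.sum_apply _ hA] at hω'
          have h1 : Tendsto (fun J => (partialSum J ω).1 A) atTop (𝓝 ∞) := by
            rw [← hω']
            simp only [coe_partialSum, Measure.finsetSum_apply]
            exact ENNReal.tendsto_nat_tsum _
          have h2 : Tendsto (fun J => ((partialSum J ω).1 A).toReal) atTop atTop := by
            refine tendsto_atTop.2 fun b => ?_
            filter_upwards [h1.eventually (lt_mem_nhds (ENNReal.ofReal_lt_top (r := b)))] with J hJ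
            exact (ENNReal.ofReal_le_iff_le_toReal (hfin _)).1 hJ.le
          have h3 : Tendsto (fun J =>
              ENNReal.ofReal (1 - Real.exp (-(t * ((partialSum J ω).1 A).toReal)))) atTop
              (𝓝 1) := by
            have h4 : Tendsto (fun J => Real.exp (-(t * ((partialSum J ω).1 A).toReal))) atTop
                (𝓝 0) :=
              Real.tendsto_exp_atBot.comp (tendsto_neg_atTop_atBot.comp (h2.const_mul_atTop ht))
            have h5 := ENNReal.tendsto_ofReal (h4.const_sub 1)
            simpa using h5
          exact h3.liminf_eq.ge
        · rw [indicator_of_notMem hω]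
          exact zero_le
    _ ≤ liminf (fun J => ∫⁻ ω,
          ENNReal.ofReal (1 - Real.exp (-(t * ((partialSum J ω).1 A).toReal)))
          ∂(jointLaw ν)) atTop := lintegral_liminf_le hmJ
    _ ≤ _ := liminf_le_of_frequently_le' (Frequently.of_forall hJ)

/-! ### Existence of completely random measures -/

/-- The integrability conditions on a Lévy measure under which the completely random measure
exists. -/
structure IsLevy (m : Measure (Rd d × ℝ)) : Prop where
  ae_pos : ∀ᵐ p ∂m, 0 < p.2
  lintegral_lt_top : ∀ R : ℕ,
    ∫⁻ p in Metric.closedBall (0 : Rd d) R ×ˢ univ, ENNReal.ofReal (min 1 p.2) ∂m < ∞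

theorem IsLevy.mono {m m' : Measure (Rd d × ℝ)} (hm : IsLevy m) (h : m' ≤ m) : IsLevy m' where
  ae_pos := h.absolutelyContinuous.ae_le hm.ae_pos
  lintegral_lt_top R :=
    (lintegral_mono' (Measure.restrict_mono le_rfl h) le_rfl).trans_lt (hm.lintegral_lt_top R)

/-- The integrand vanishes off a ball and is bounded by `max 2 C * min 1 s`: by `2` for large `s`,
by `|s f|` for small `s`. -/
theorem IsLevy.integrable {m : Measure (Rd d × ℝ)} (hm : IsLevy m) {f : Rd d → ℝ}
    (hf : Continuous f) (hc : HasCompactSupport f) :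
    Integrable (fun p : Rd d × ℝ => Complex.exp (Complex.I * ((p.2 * f p.1 : ℝ) : ℂ)) - 1) m := by
  obtain ⟨C, hC⟩ := hc.exists_bound_of_continuous hf
  obtain ⟨r, hr⟩ := hc.isCompact.isBounded.subset_closedBall (0 : Rd d)
  obtain ⟨R, hR⟩ := exists_nat_ge r
  have hB : MeasurableSet (Metric.closedBall (0 : Rd d) R ×ˢ (univ : Set ℝ)) :=
    Metric.isClosed_closedBall.measurableSet.prod MeasurableSet.univ
  have hzero : ∀ x ∉ Metric.closedBall (0 : Rd d) R, f x = 0 := fun x hx => by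
    by_contra h
    exact hx (Metric.closedBall_subset_closedBall hR (hr (subset_tsupport f h)))
  have hint : Integrable (fun p : Rd d × ℝ => min 1 p.2)
      (m.restrict (Metric.closedBall (0 : Rd d) R ×ˢ univ)) := by
    refine ⟨(measurable_const.min measurable_snd).aestronglyMeasurable, ?_⟩
    rw [hasFiniteIntegral_iff_ofReal]
    · exact hm.lintegral_lt_top R
    · filter_upwards [ae_restrict_of_ae hm.ae_pos] with p hp
      exact le_min zero_le_one hp.le
  refine Integrable.mono' ((integrable_indicator_iff hB).2 (hint.const_mul (max 2 C))) ?_ ?_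
  · have := hf.measurable
    exact Measurable.aestronglyMeasurable (by fun_prop)
  · filter_upwards [hm.ae_pos] with p hp
    by_cases hx : p.1 ∈ Metric.closedBall (0 : Rd d) R
    · rw [indicator_of_mem (show p ∈ Metric.closedBall (0 : Rd d) R ×ˢ univ from
        ⟨hx, mem_univ _⟩)]
      rcases le_total 1 p.2 with h1 | h1
      · rw [min_eq_left h1, mul_one]
        refine le_trans ?_ (le_max_left _ _)
        refine (norm_sub_le _ _).trans ?_
        rw [mul_comm Complex.I, Complex.norm_exp_ofReal_mul_I, norm_one]
        norm_num
      · rw [min_eq_right h1]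
        refine Real.norm_exp_I_mul_ofReal_sub_one_le.trans ?_
        rw [norm_mul, Real.norm_of_nonneg hp.le, mul_comm]
        exact mul_le_mul_of_nonneg_right ((hC _).trans (le_max_right _ _)) hp.le
    · rw [indicator_of_notMem (fun h => hx h.1), hzero _ hx]
      simp

/-- The sum of a sequence in `𝕂(X)` where it is locally finite, and `0` elsewhere. -/
noncomputable def totalSum (ω : ℕ → DiscreteRadon d) : DiscreteRadon d := by
  classical
  exact if h : ∀ R : ℕ, Measure.sum (fun j => (ω j).1) (Metric.closedBall 0 R) < ∞ then
    ⟨Measure.sum fun j => (ω j).1, by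
      choose τ hτ h0 using fun j => (ω j).2.exists_countable
      refine isDiscreteRadon_of_countable (fun K hK => ?_) (countable_iUnion hτ) ?_
      · obtain ⟨r, hr⟩ := hK.isBounded.subset_closedBall (0 : Rd d)
        obtain ⟨R, hR⟩ := exists_nat_ge r
        exact (measure_mono (hr.trans (Metric.closedBall_subset_closedBall hR))).trans_lt (h R)
      · rw [Measure.sum_apply_eq_zero]
        refine fun j => measure_mono_null (compl_subset_compl.2 (subset_iUnion τ j)) (h0 j)⟩
  else 0

theorem coe_totalSum {ω : ℕ → DiscreteRadon d}
    (h : ∀ R : ℕ, Measure.sum (fun j => (ω j).1) (Metric.closedBall 0 R) < ∞) :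
    (totalSum ω).1 = Measure.sum fun j => (ω j).1 := by
  rw [totalSum, dif_pos h]

theorem measurable_totalSum :
    Measurable (totalSum : (ℕ → DiscreteRadon d) → DiscreteRadon d) := by
  classical
  have hs : ∀ A : Set (Rd d), MeasurableSet A →
      Measurable fun ω : ℕ → DiscreteRadon d => Measure.sum (fun j => (ω j).1) A := by
    intro A hA
    simp only [Measure.sum_apply _ hA]
    exact Measurable.tsum fun j =>
      (DiscreteRadon.measurable_apply hA).comp (measurable_pi_apply j)
  have hfin : MeasurableSet {ω : ℕ → DiscreteRadon d |
      ∀ R : ℕ, Measure.sum (fun j => (ω j).1) (Metric.closedBall 0 R) < ∞} := by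
    have : {ω : ℕ → DiscreteRadon d |
        ∀ R : ℕ, Measure.sum (fun j => (ω j).1) (Metric.closedBall 0 R) < ∞} =
        ⋂ R : ℕ, {ω | Measure.sum (fun j => (ω j).1) (Metric.closedBall 0 R) < ∞} := by
      ext
      simp
    rw [this]
    exact MeasurableSet.iInter fun R =>
      hs _ Metric.isClosed_closedBall.measurableSet measurableSet_Iio
  refine DiscreteRadon.measurable_of_apply fun A hA => ?_
  have : (fun ω : ℕ → DiscreteRadon d => (totalSum ω).1 A) = fun ω =>
      if ∀ R : ℕ, Measure.sum (fun j => (ω j).1) (Metric.closedBall 0 R) < ∞ then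
        Measure.sum (fun j => (ω j).1) A else 0 := by
    funext ω
    split_ifs with h
    · rw [coe_totalSum h]
    · rw [totalSum, dif_neg h]
      rfl
  rw [this]
  exact Measurable.ite hfin (hs A hA) measurable_const

/-- Take `t = 1 / (n + 1) → 0` in the explosion bound; `min 1 s` dominates. -/
theorem ae_sum_closedBall_lt_top (ν : ℕ → Measure (Rd d × ℝ)) [∀ j, IsFiniteMeasure (ν j)]
    (hm : IsLevy (Measure.sum ν)) :
    ∀ᵐ ω ∂(jointLaw ν), ∀ R : ℕ, Measure.sum (fun j => (ω j).1) (Metric.closedBall 0 R) < ∞ := by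
  rw [ae_all_iff]
  intro R
  have hA : MeasurableSet (Metric.closedBall (0 : Rd d) R) :=
    Metric.isClosed_closedBall.measurableSet
  have hfin : ∀ η : DiscreteRadon d, η.1 (Metric.closedBall (0 : Rd d) R) ≠ ∞ := fun η =>
    (η.2.1 _ (isCompact_closedBall _ _)).ne
  have hlim : Tendsto (fun n : ℕ => ∫⁻ p in Metric.closedBall (0 : Rd d) R ×ˢ univ,
      ENNReal.ofReal (min 1 (1 / ((n : ℝ) + 1) * p.2)) ∂(Measure.sum ν)) atTop (𝓝 0) := by
    have h0 : (0 : ℝ≥0∞) = ∫⁻ _ in Metric.closedBall (0 : Rd d) R ×ˢ (univ : Set ℝ),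
        0 ∂(Measure.sum ν) := by simp
    rw [h0]
    refine tendsto_lintegral_of_dominated_convergence
      (fun p => ENNReal.ofReal (min 1 p.2)) (fun n => Measurable.ennreal_ofReal (by fun_prop))
      (fun n => ?_) (hm.lintegral_lt_top R).ne (ae_of_all _ fun p => ?_)
    · filter_upwards [ae_restrict_of_ae hm.ae_pos] with p hp
      refine ENNReal.ofReal_le_ofReal (min_le_min le_rfl ?_)
      refine mul_le_of_le_one_left hp.le ?_
      rw [div_le_one (by positivity)]
      exact le_add_of_nonneg_left n.cast_nonneg
    · have h1 : Tendsto (fun n : ℕ => min 1 (1 / ((n : ℝ) + 1) * p.2)) atTop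
          (𝓝 (min 1 (0 * p.2))) :=
        tendsto_const_nhds.min (tendsto_one_div_add_atTop_nhds_zero_nat.mul_const _)
      have h2 := ENNReal.tendsto_ofReal h1
      simpa using h2
  have : jointLaw ν {ω | Measure.sum (fun j => (ω j).1) (Metric.closedBall 0 R) = ∞} = 0 :=
    le_antisymm (ge_of_tendsto' hlim fun n =>
      measure_sum_eq_top_le ν hA hfin (by positivity)) zero_le
  rw [ae_iff]
  refine measure_mono_null (fun ω hω => ?_) this
  simpa using hω

theorem tendsto_fourierFun_partialSum {f : Rd d → ℝ} (hf : Continuous f)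
    (hc : HasCompactSupport f) {ω : ℕ → DiscreteRadon d}
    (h : ∀ R : ℕ, Measure.sum (fun j => (ω j).1) (Metric.closedBall 0 R) < ∞) :
    Tendsto (fun J => fourierFun f (partialSum J ω)) atTop (𝓝 (fourierFun f (totalSum ω))) := by
  have h1 := integrable_of_continuous (totalSum ω) hf hc
  have h2 : Tendsto (fun J => ∫ x, f x ∂(partialSum J ω).1) atTop
      (𝓝 (∫ x, f x ∂(totalSum ω).1)) := by
    rw [coe_totalSum h] at h1 ⊢
    have h3 := (hasSum_integral_measure h1).tendsto_sum_nat
    refine h3.congr fun J => ?_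
    rw [coe_partialSum,
      integral_finsetSum_measure fun j _ => integrable_of_continuous (ω j) hf hc]
  have hcont : Continuous fun a : ℝ => Complex.exp (Complex.I * (a : ℂ)) := by fun_prop
  exact (hcont.tendsto _).comp h2

/-- The identity holds for partial sums; the left side converges since the functionals are bounded
by `1`, the exponent since its integrand is integrable for the full Lévy measure. -/
theorem isCompletelyRandom_map_totalSum (ν : ℕ → Measure (Rd d × ℝ))
    [∀ j, IsFiniteMeasure (ν j)] (hm : IsLevy (Measure.sum ν)) :
    IsCompletelyRandomWithLevyMeasure (Measure.sum ν) ((jointLaw ν).map totalSum) := by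
  refine ⟨Measure.isProbabilityMeasure_map measurable_totalSum.aemeasurable, fun f hf hc => ?_⟩
  have hΦ := isMultiplicative_fourierFun hf hc
  have h1 : Tendsto (fun J => ∫ ω, fourierFun f (partialSum J ω) ∂(jointLaw ν)) atTop
      (𝓝 (∫ ω, fourierFun f (totalSum ω) ∂(jointLaw ν))) := by
    refine tendsto_integral_of_dominated_convergence (fun _ => (1 : ℝ))
      (fun J => (hΦ.measurable.comp (measurable_partialSum J)).aestronglyMeasurable)
      (integrable_const _) (fun J => ae_of_all _ fun ω => hΦ.norm_le _) ?_
    filter_upwards [ae_sum_closedBall_lt_top ν hm] with ω hω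
    exact tendsto_fourierFun_partialSum hf hc hω
  have hint := hm.integrable hf hc
  have h2 : ∀ j, ∫ p, (fourierFun f (atom p) - 1) ∂(ν j) =
      ∫ p : Rd d × ℝ, (Complex.exp (Complex.I * ((p.2 * f p.1 : ℝ) : ℂ)) - 1) ∂(ν j) := by
    intro j
    refine integral_congr_ae ?_
    filter_upwards [(Measure.le_sum ν j).absolutelyContinuous.ae_le hm.ae_pos] with p hp
    rw [fourierFun_atom f hp]
  have h3 := (Complex.continuous_exp.tendsto _).comp (hasSum_integral_measure hint).tendsto_sum_nat
  have h4 : (fun J => ∫ ω, fourierFun f (partialSum J ω) ∂(jointLaw ν)) = Complex.exp ∘ fun J =>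
      ∑ j ∈ Finset.range J,
        ∫ p : Rd d × ℝ, (Complex.exp (Complex.I * ((p.2 * f p.1 : ℝ) : ℂ)) - 1) ∂(ν j) := by
    funext J
    rw [integral_jointLaw_partialSum ν hΦ J]
    simp_rw [h2]
    rfl
  rw [h4] at h1
  change ∫ η, fourierFun f η ∂((jointLaw ν).map totalSum) = _
  rw [integral_map measurable_totalSum.aemeasurable hΦ.measurable.aestronglyMeasurable]
  exact tendsto_nhds_unique h1 h3

theorem IsCompletelyRandomWithLevyMeasure.unique {m : Measure (Rd d × ℝ)}
    {P Q : Measure (DiscreteRadon d)} (hP : IsCompletelyRandomWithLevyMeasure m P)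
    (hQ : IsCompletelyRandomWithLevyMeasure m Q) : P = Q := by
  have := hP.1
  have := hQ.1
  exact measure_ext_of_fourier fun f hf hc => (hP.2 f hf hc).trans (hQ.2 f hf hc).symm

theorem IsLevy.exists_isCompletelyRandom {m : Measure (Rd d × ℝ)} [SFinite m] (hm : IsLevy m) :
    ∃ P : Measure (DiscreteRadon d), IsCompletelyRandomWithLevyMeasure m P := by
  rw [← sum_sfiniteSeq m] at hm ⊢
  exact ⟨_, isCompletelyRandom_map_totalSum _ hm⟩

theorem isCompletelyRandom_finiteLaw {m : Measure (Rd d × ℝ)} [IsFiniteMeasure m]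
    (hm : ∀ᵐ p ∂m, 0 < p.2) : IsCompletelyRandomWithLevyMeasure m (finiteLaw m) := by
  refine ⟨inferInstance, fun f hf hc => ?_⟩
  refine (integral_finiteLaw m (isMultiplicative_fourierFun hf hc)).trans ?_
  congr 1
  refine integral_congr_ae ?_
  filter_upwards [hm] with p hp
  rw [fourierFun_atom f hp]

theorem coe_totalSum_apply_singleton {ω : ℕ → DiscreteRadon d}
    (h : ∀ R : ℕ, Measure.sum (fun j => (ω j).1) (Metric.closedBall 0 R) < ∞) (x : Rd d) :
    Tendsto (fun J => (partialSum J ω).1 {x}) atTop (𝓝 ((totalSum ω).1 {x})) := by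
  rw [coe_totalSum h, Measure.sum_apply _ (measurableSet_singleton x)]
  simp only [coe_partialSum, Measure.finsetSum_apply]
  exact ENNReal.tendsto_nat_tsum _

/-- By uniqueness `P` may be replaced by the constructed law, whose atoms are limits of those of
partial sums; for the latter the claim is known from the finite case. -/
theorem IsCompletelyRandomWithLevyMeasure.ae_measure_singleton {m : Measure (Rd d × ℝ)}
    [SFinite m] (hm : IsLevy m) {P : Measure (DiscreteRadon d)}
    (hP : IsCompletelyRandomWithLevyMeasure m P) {x : Rd d} (hx : m ({x} ×ˢ univ) = 0) :
    ∀ᵐ η ∂P, η.1 {x} = 0 := by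
  rw [← sum_sfiniteSeq m] at hm hP hx
  set ν := sfiniteSeq m
  rw [hP.unique (isCompletelyRandom_map_totalSum _ hm),
    ae_map_iff measurable_totalSum.aemeasurable (measurableSet_measure_singleton_eq_zero x)]
  have h1 : ∀ᵐ ω ∂(jointLaw ν), ∀ J, (partialSum J ω).1 {x} = 0 := by
    rw [ae_all_iff]
    intro J
    refine ae_of_ae_map (measurable_partialSum J).aemeasurable
      (p := fun η : DiscreteRadon d => η.1 {x} = 0) ?_
    rw [map_partialSum_jointLaw]
    exact ae_finiteLaw fun k => ae_convPow_measure_singleton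
      ((finsetSum_le_sum ν J).absolutelyContinuous hx) k
  filter_upwards [h1, ae_sum_closedBall_lt_top ν hm] with ω hω hω'
  refine tendsto_nhds_unique (coe_totalSum_apply_singleton hω' x) ?_
  simp only [hω]
  exact tendsto_const_nhds

theorem IsCompletelyRandomWithLevyMeasure.ae_forall_measure_singleton_le
    {m : Measure (Rd d × ℝ)} [SFinite m] (hm : IsLevy m) {P : Measure (DiscreteRadon d)}
    (hP : IsCompletelyRandomWithLevyMeasure m P) (h0 : ∀ x : Rd d, m ({x} ×ˢ univ) = 0) {c : ℝ}
    (hc : ∀ᵐ p ∂m, p.2 ≤ c) : ∀ᵐ η ∂P, ∀ x, η.1 {x} ≤ ENNReal.ofReal c := by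
  rw [← sum_sfiniteSeq m] at hm hP h0 hc
  set ν := sfiniteSeq m
  rw [hP.unique (isCompletelyRandom_map_totalSum _ hm),
    ae_map_iff measurable_totalSum.aemeasurable (measurableSet_forall_measure_singleton_le _)]
  have h1 : ∀ᵐ ω ∂(jointLaw ν), ∀ J, ∀ x, (partialSum J ω).1 {x} ≤ ENNReal.ofReal c := by
    rw [ae_all_iff]
    intro J
    refine ae_of_ae_map (measurable_partialSum J).aemeasurable
      (p := fun η : DiscreteRadon d => ∀ x, η.1 {x} ≤ ENNReal.ofReal c) ?_
    rw [map_partialSum_jointLaw]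
    have hac := (finsetSum_le_sum ν J).absolutelyContinuous
    exact ae_finiteLaw fun k => ae_convPow_forall_measure_singleton_le
      (fun x => hac (h0 x)) (hac.ae_le hc) k
  filter_upwards [h1, ae_sum_closedBall_lt_top ν hm] with ω hω hω' x
  exact le_of_tendsto' (coe_totalSum_apply_singleton hω' x) fun J => hω J x

theorem IsCompletelyRandomWithLevyMeasure.add {m₁ m₂ : Measure (Rd d × ℝ)} (h₁ : IsLevy m₁)
    (h₂ : IsLevy m₂) {P₁ P₂ : Measure (DiscreteRadon d)}
    (hP₁ : IsCompletelyRandomWithLevyMeasure m₁ P₁)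
    (hP₂ : IsCompletelyRandomWithLevyMeasure m₂ P₂) :
    IsCompletelyRandomWithLevyMeasure (m₁ + m₂) ((P₁.prod P₂).map fun p => p.1 + p.2) := by
  have := hP₁.1
  have := hP₂.1
  refine ⟨Measure.isProbabilityMeasure_map DiscreteRadon.measurable_add.aemeasurable,
    fun f hf hc => ?_⟩
  have hΦ := isMultiplicative_fourierFun hf hc
  change ∫ η, fourierFun f η ∂((P₁.prod P₂).map fun p => p.1 + p.2) = _
  rw [integral_map DiscreteRadon.measurable_add.aemeasurable
    hΦ.measurable.aestronglyMeasurable]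
  simp_rw [hΦ.map_add]
  rw [integral_prod_mul (fourierFun f) (fourierFun f),
    integral_add_measure (h₁.integrable hf hc) (h₂.integrable hf hc), Complex.exp_add]
  exact congrArg₂ (· * ·) (hP₁.2 f hf hc) (hP₂.2 f hf hc)

/-! ### The filtration generated by the large atoms -/

/-- The set of `x` such that `(x, η {x})` lies in `Λ`. -/
def markedSet (Λ : Set (Rd d × ℝ)) (η : DiscreteRadon d) : Set (Rd d) :=
  {x | (x, (η.1 {x}).toReal) ∈ Λ}

/-- The marked sets entering the definition of `weightFiltration d n`. -/
structure IsAdmissible (n : ℕ) (Λ : Set (Rd d × ℝ)) : Prop where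
  measurableSet : MeasurableSet Λ
  isCompact_closure : IsCompact (closure Λ)
  subset : Λ ⊆ univ ×ˢ Ici (1 / ((n : ℝ) + 1))

theorem IsAdmissible.pos {n : ℕ} {Λ : Set (Rd d × ℝ)} (h : IsAdmissible n Λ) {p : Rd d × ℝ}
    (hp : p ∈ Λ) : 0 < p.2 :=
  lt_of_lt_of_le (by positivity) (h.subset hp).2

theorem weightFiltration_le_iff {n : ℕ} {𝓜 : MeasurableSpace (DiscreteRadon d)} :
    weightFiltration d n ≤ 𝓜 ↔ ∀ Λ : Set (Rd d × ℝ), IsAdmissible n Λ →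
      @Measurable _ _ 𝓜 ⊤ fun η : DiscreteRadon d => (markedSet Λ η).encard := by
  simp only [weightFiltration, iSup_le_iff]
  constructor
  · exact fun h Λ hΛ => measurable_iff_comap_le.2
      (h Λ hΛ.measurableSet hΛ.isCompact_closure hΛ.subset)
  · exact fun h Λ h1 h2 h3 => measurable_iff_comap_le.1 (h Λ ⟨h1, h2, h3⟩)

theorem measurable_encard_markedSet {n : ℕ} {Λ : Set (Rd d × ℝ)} (hΛ : IsAdmissible n Λ) :
    @Measurable _ _ (weightFiltration d n) ⊤
      fun η : DiscreteRadon d => (markedSet Λ η).encard :=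
  weightFiltration_le_iff.1 le_rfl Λ hΛ

theorem weightFiltration_mono : Monotone (weightFiltration d) := by
  intro n k hnk
  refine weightFiltration_le_iff.2 fun Λ hΛ => measurable_encard_markedSet
    ⟨hΛ.measurableSet, hΛ.isCompact_closure, hΛ.subset.trans (prod_mono le_rfl ?_)⟩
  refine Ici_subset_Ici.2 (one_div_le_one_div_of_le (by positivity) ?_)
  exact_mod_cast Nat.succ_le_succ hnk

/-- The sets that do not separate `η` from `ζ` form a σ-algebra, and it contains the generators. -/
theorem mem_iff_mem_of_markedSet_eq {n : ℕ} {η ζ : DiscreteRadon d}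
    (h : ∀ Λ : Set (Rd d × ℝ), IsAdmissible n Λ → markedSet Λ η = markedSet Λ ζ)
    {A : Set (DiscreteRadon d)} (hA : MeasurableSet[weightFiltration d n] A) :
    η ∈ A ↔ ζ ∈ A := by
  let 𝓜 : MeasurableSpace (DiscreteRadon d) :=
    { MeasurableSet' := fun A => η ∈ A ↔ ζ ∈ A
      measurableSet_empty := Iff.rfl
      measurableSet_compl := fun A hA => not_congr hA
      measurableSet_iUnion := fun f hf => by
        simp only [mem_iUnion]
        exact exists_congr hf }
  have hle : weightFiltration d n ≤ 𝓜 := by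
    refine weightFiltration_le_iff.2 fun Λ hΛ B _ => ?_
    change (markedSet Λ η).encard ∈ B ↔ (markedSet Λ ζ).encard ∈ B
    rw [h Λ hΛ]
  exact hle A hA

/-- Weighting each atom by the inverse of its mass turns counting into integration against `η`,
which is jointly measurable. -/
theorem encard_markedSet_eq_lintegral {Λ : Set (Rd d × ℝ)} (hpos : ∀ p ∈ Λ, 0 < p.2)
    (η : DiscreteRadon d) :
    ((markedSet Λ η).encard : ℝ≥0∞) =
      ∫⁻ x, Λ.indicator 1 (x, (η.1 {x}).toReal) * (η.1 {x})⁻¹ ∂η.1 := by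
  rw [DiscreteRadon.lintegral_eq_tsum, ← ENNReal.tsum_set_one,
    tsum_subtype (markedSet Λ η) fun _ => (1 : ℝ≥0∞)]
  refine tsum_congr fun x => ?_
  by_cases hx : x ∈ markedSet Λ η
  · have hx' : (x, (η.1 {x}).toReal) ∈ Λ := hx
    have h0 : η.1 {x} ≠ 0 := fun h0 => by
      have := hpos _ hx'
      simp [h0] at this
    rw [indicator_of_mem hx, indicator_of_mem hx', Pi.one_apply, one_mul,
      ENNReal.inv_mul_cancel h0 (η.measure_singleton_ne_top x)]
  · rw [indicator_of_notMem hx, indicator_of_notMem (by exact hx), zero_mul, zero_mul]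

theorem measurable_enat_of_coe {α : Type*} [MeasurableSpace α] {f : α → ℕ∞}
    (h : Measurable fun a => ((f a : ℕ∞) : ℝ≥0∞)) : @Measurable _ _ _ ⊤ f := by
  intro B _
  have : f ⁻¹' B = (fun a => ((f a : ℕ∞) : ℝ≥0∞)) ⁻¹' ((fun k : ℕ∞ => (k : ℝ≥0∞)) '' B) := by
    ext a
    simp only [mem_preimage, mem_image]
    exact ⟨fun ha => ⟨f a, ha, rfl⟩, fun ⟨k, hk, hka⟩ => ENat.toENNReal_inj.1 hka ▸ hk⟩
  rw [this]
  exact h ((B.to_countable.image _).measurableSet)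

theorem weightFiltration_le (n : ℕ) :
    weightFiltration d n ≤ (inferInstance : MeasurableSpace (DiscreteRadon d)) := by
  refine weightFiltration_le_iff.2 fun Λ hΛ => measurable_enat_of_coe ?_
  simp_rw [encard_markedSet_eq_lintegral fun p hp => hΛ.pos hp]
  refine DiscreteRadon.measurable_lintegral_joint (f := fun q : DiscreteRadon d × Rd d =>
    Λ.indicator 1 (q.2, (q.1.1 {q.2}).toReal) * (q.1.1 {q.2})⁻¹) ?_
  have hm := DiscreteRadon.measurable_measure_singleton (d := d)
  exact ((measurable_one.indicator hΛ.measurableSet).comp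
    (measurable_snd.prodMk hm.ennreal_toReal)).mul hm.inv

/-- The measure `∑ δ_(x, η {x})` over the atoms `x` of `η`. -/
noncomputable def atomMeasure (η : DiscreteRadon d) : Measure (Rd d × ℝ) :=
  ((Measure.count : Measure (Rd d)).map fun x => (x, (η.1 {x}).toReal)).restrict
    (univ ×ˢ Ioi 0)

theorem measurable_prodMk_measure_singleton (η : DiscreteRadon d) :
    Measurable fun x : Rd d => (x, (η.1 {x}).toReal) :=
  measurable_id.prodMk (η.measurable_measure_singleton_right).ennreal_toReal

theorem atomMeasure_apply (η : DiscreteRadon d) {Λ : Set (Rd d × ℝ)} (hΛ : MeasurableSet Λ) :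
    atomMeasure η Λ = (markedSet (Λ ∩ univ ×ˢ Ioi 0) η).encard := by
  have hI : MeasurableSet (univ ×ˢ Ioi 0 : Set (Rd d × ℝ)) :=
    MeasurableSet.univ.prod measurableSet_Ioi
  rw [atomMeasure, Measure.restrict_apply hΛ,
    Measure.map_apply (measurable_prodMk_measure_singleton η) (hΛ.inter hI),
    Measure.count_apply (measurable_prodMk_measure_singleton η (hΛ.inter hI))]
  rfl

theorem lintegral_atomMeasure (η : DiscreteRadon d) {A : Set (Rd d)} (hA : MeasurableSet A) :
    ∫⁻ p, A.indicator 1 p.1 * ENNReal.ofReal p.2 ∂(atomMeasure η) = η.1 A := by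
  have hI : MeasurableSet (univ ×ˢ Ioi 0 : Set (Rd d × ℝ)) :=
    MeasurableSet.univ.prod measurableSet_Ioi
  have hm : Measurable fun p : Rd d × ℝ => A.indicator (1 : Rd d → ℝ≥0∞) p.1 *
      ENNReal.ofReal p.2 :=
    ((measurable_one.indicator hA).comp measurable_fst).mul measurable_snd.ennreal_ofReal
  rw [atomMeasure, ← lintegral_indicator hI, lintegral_map (hm.indicator hI)
    (measurable_prodMk_measure_singleton η), lintegral_count, ← lintegral_indicator_one hA,
    DiscreteRadon.lintegral_eq_tsum]
  refine tsum_congr fun x => ?_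
  by_cases h0 : η.1 {x} = 0
  · rw [h0, indicator_of_notMem (by simp), mul_zero]
  · have hx : (x, (η.1 {x}).toReal) ∈ (univ ×ˢ Ioi 0 : Set (Rd d × ℝ)) :=
      ⟨mem_univ _, ENNReal.toReal_pos h0 (η.measure_singleton_ne_top x)⟩
    rw [indicator_of_mem hx,
      ENNReal.ofReal_toReal (η.measure_singleton_ne_top x)]

/-- The counts determine `η`: the windows `B n` exhaust `X × (0, ∞)`, so the counts give
`atomMeasure` on all Borel sets, and `η A` is the integral of the weight over atoms in `A`. -/
theorem measurable_of_encard_markedSet {α : Type*} [MeasurableSpace α] {G : α → DiscreteRadon d}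
    (h : ∀ (n : ℕ) (Λ : Set (Rd d × ℝ)), IsAdmissible n Λ →
      @Measurable _ _ _ ⊤ fun a => (markedSet Λ (G a)).encard) : Measurable G := by
  let B : ℕ → Set (Rd d × ℝ) := fun n =>
    Metric.closedBall 0 n ×ˢ Icc (1 / ((n : ℝ) + 1)) n
  have hBc : ∀ n, IsCompact (B n) := fun n => (isCompact_closedBall _ _).prod isCompact_Icc
  have hBmono : Monotone B := by
    intro n k hnk
    have hnk' : (n : ℝ) ≤ k := by exact_mod_cast hnk
    refine prod_mono (Metric.closedBall_subset_closedBall hnk') (Icc_subset_Icc ?_ hnk')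
    exact one_div_le_one_div_of_le (by positivity) (by linarith)
  have hBU : ⋃ n, B n = univ ×ˢ Ioi 0 := by
    ext p
    simp only [mem_iUnion]
    constructor
    · rintro ⟨n, -, hp⟩
      exact ⟨mem_univ _, lt_of_lt_of_le (by positivity) hp.1⟩
    · intro hp'
      have hp : 0 < p.2 := hp'.2
      obtain ⟨n, hn⟩ := exists_nat_ge (max (dist p.1 0) p.2)
      obtain ⟨k, hk⟩ := exists_nat_one_div_lt hp
      refine ⟨max n k, mem_prod.2 ⟨Metric.mem_closedBall.2 ?_, mem_Icc.2 ⟨?_, ?_⟩⟩⟩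
      · exact ((le_max_left _ _).trans hn).trans (by exact_mod_cast le_max_left n k)
      · refine le_trans (one_div_le_one_div_of_le (by positivity) ?_) hk.le
        have : (k : ℝ) ≤ ((max n k : ℕ) : ℝ) := by exact_mod_cast le_max_right n k
        linarith
      · exact ((le_max_right _ _).trans hn).trans (by exact_mod_cast le_max_left n k)
  have hΞ : Measurable fun a => atomMeasure (G a) := by
    refine Measure.measurable_of_measurable_coe _ fun Λ hΛ => ?_
    have hadm : ∀ n, IsAdmissible n (Λ ∩ B n) := fun n =>
      ⟨hΛ.inter (hBc n).measurableSet,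
        (hBc n).closure_of_subset inter_subset_right,
        fun p hp => ⟨mem_univ _, hp.2.2.1⟩⟩
    have h1 : (fun a => atomMeasure (G a) Λ) =
        fun a => ⨆ n, ((markedSet (Λ ∩ B n) (G a)).encard : ℝ≥0∞) := by
      funext a
      have h2 : atomMeasure (G a) Λ = atomMeasure (G a) (⋃ n, Λ ∩ B n) := by
        rw [← inter_iUnion, hBU, atomMeasure_apply _ hΛ,
          atomMeasure_apply _ (hΛ.inter (MeasurableSet.univ.prod measurableSet_Ioi)),
          inter_assoc, inter_self]
      rw [h2, Monotone.measure_iUnion fun i j hij => inter_subset_inter_right Λ (hBmono hij)]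
      refine iSup_congr fun n => ?_
      rw [atomMeasure_apply _ (hadm n).measurableSet, inter_eq_left.2]
      exact fun p hp => ⟨mem_univ _, (hadm n).pos hp⟩
    rw [h1]
    refine Measurable.iSup fun n => ?_
    exact (show @Measurable _ _ ⊤ _ (fun k : ℕ∞ => (k : ℝ≥0∞)) from measurable_from_top).comp
      (h n _ (hadm n))
  refine DiscreteRadon.measurable_of_apply fun A hA => ?_
  have hm : Measurable fun p : Rd d × ℝ => A.indicator (1 : Rd d → ℝ≥0∞) p.1 *
      ENNReal.ofReal p.2 :=
    ((measurable_one.indicator hA).comp measurable_fst).mul measurable_snd.ennreal_ofReal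
  simp_rw [← lintegral_atomMeasure _ hA]
  exact (Measure.measurable_lintegral hm).comp hΞ

theorem iSup_weightFiltration :
    ⨆ n, weightFiltration d n = (inferInstance : MeasurableSpace (DiscreteRadon d)) := by
  refine le_antisymm (iSup_le weightFiltration_le) ?_
  have : @Measurable _ _ (⨆ n, weightFiltration d n) _ (id : DiscreteRadon d → DiscreteRadon d) :=
    @measurable_of_encard_markedSet d _ (⨆ n, weightFiltration d n) id fun n Λ hΛ =>
      (measurable_encard_markedSet hΛ).mono (le_iSup _ n) le_rfl
  exact fun A hA => this hA

/-! ### The action on atoms -/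

/-- The action of `g = (φ, θ)` on an atom: `(x, s) ↦ (φ x, θ(φ x) s)`. -/
noncomputable def actPoint (g : DiffCurrent d) (p : Rd d × ℝ) : Rd d × ℝ :=
  (g.right.1 p.1, (g.left.1 (g.right.1 p.1) : ℝ) * p.2)

theorem continuous_current (θ : Current d) : Continuous fun x => (θ.1 x : ℝ) :=
  continuous_subtype_val.comp θ.2.1

theorem continuous_actPoint (g : DiffCurrent d) : Continuous (actPoint g) := by
  have h1 : Continuous fun p : Rd d × ℝ => g.right.1 p.1 :=
    g.right.2.1.continuous.comp continuous_fst
  exact h1.prodMk (((continuous_current g.left).comp h1).mul continuous_snd)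

theorem exists_nat_current_le (θ : Current d) : ∃ C : ℕ, 0 < C ∧ ∀ x, (θ.1 x : ℝ) ≤ C := by
  obtain ⟨K, hK, h1⟩ := θ.2.2
  obtain ⟨b, hb⟩ := (hK.image (continuous_current θ)).bddAbove
  obtain ⟨C, hC⟩ := exists_nat_ge b
  refine ⟨C + 1, Nat.succ_pos _, fun x => ?_⟩
  push_cast
  by_cases hx : x ∈ K
  · linarith [hb (mem_image_of_mem _ hx)]
  · rw [h1 x hx]
    simp

theorem smul_measure_singleton (g : DiffCurrent d) (η : DiscreteRadon d) (x : Rd d) :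
    ((g • η).1 {g.right.1 x}).toReal = (g.left.1 (g.right.1 x) : ℝ) * (η.1 {x}).toReal := by
  have h : (g • η).1 {g.right.1 x} = Current.density g.left (g.right.1 x) * η.1 {x} := by
    refine (actMeasure_apply g η.1 (measurableSet_singleton _)).trans ?_
    rw [← lintegral_indicator_const (measurableSet_singleton x)]
    refine lintegral_congr fun y => ?_
    by_cases hy : y = x
    · subst hy
      rw [indicator_of_mem (mem_singleton _), indicator_of_mem (mem_singleton _)]
    · rw [indicator_of_notMem (by simpa using hy),
        indicator_of_notMem (by simpa using hy)]
  rw [h, ENNReal.toReal_mul, Current.density, ENNReal.toReal_ofReal (g.left.1 _).2.le]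

theorem markedSet_smul (g : DiffCurrent d) (Λ : Set (Rd d × ℝ)) (η : DiscreteRadon d) :
    markedSet Λ (g • η) = g.right.1 '' markedSet (actPoint g ⁻¹' Λ) η := by
  ext y
  constructor
  · intro hy
    refine ⟨g.right.1.symm y, ?_, g.right.1.apply_symm_apply y⟩
    change (_, _) ∈ Λ
    rw [← smul_measure_singleton, Equiv.apply_symm_apply]
    exact hy
  · rintro ⟨x, hx, rfl⟩
    change (_, _) ∈ Λ
    rw [smul_measure_singleton]
    exact hx

theorem exists_isAdmissible_preimage_actPoint (g : DiffCurrent d) (n : ℕ) :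
    ∃ k : ℕ, ∀ Λ : Set (Rd d × ℝ), IsAdmissible n Λ → IsAdmissible k (actPoint g ⁻¹' Λ) := by
  obtain ⟨C, hC0, hC⟩ := exists_nat_current_le g.left
  -- Since `θ ≤ C`, a weight at least `1 / (n + 1)` after the action was at least `1 / ((n + 1) C)`
  -- before it, which exceeds `1 / ((n + 1) C + 1)`.
  refine ⟨(n + 1) * C, fun Λ hΛ => ⟨(continuous_actPoint g).measurable hΛ.measurableSet, ?_, ?_⟩⟩
  · have hc : Continuous fun p : Rd d × ℝ =>
        (g.right.1.symm p.1, (g.left.1 p.1 : ℝ)⁻¹ * p.2) :=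
      (g.right.2.2.1.continuous.comp continuous_fst).prodMk
        ((((continuous_current g.left).inv₀ fun x => (g.left.1 x).2.ne').comp
          continuous_fst).mul continuous_snd)
    refine (hΛ.isCompact_closure.image hc).closure_of_subset fun p hp => ?_
    refine ⟨actPoint g p, subset_closure hp, ?_⟩
    have := (g.left.1 (g.right.1 p.1)).2.ne'
    refine Prod.ext (g.right.1.symm_apply_apply p.1) ?_
    simp only [actPoint]
    rw [inv_mul_cancel_left₀ this]
  · intro p hp
    have h1 : 1 / ((n : ℝ) + 1) ≤ (g.left.1 (g.right.1 p.1) : ℝ) * p.2 := (hΛ.subset hp).2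
    have h2 : 0 < (g.left.1 (g.right.1 p.1) : ℝ) * p.2 := lt_of_lt_of_le (by positivity) h1
    have h3 : 0 < p.2 := (mul_pos_iff_of_pos_left (g.left.1 _).2).1 h2
    have h4 : 1 / ((n : ℝ) + 1) ≤ C * p.2 :=
      h1.trans (mul_le_mul_of_nonneg_right (hC _) h3.le)
    have hC' : (0 : ℝ) < C := by exact_mod_cast hC0
    refine ⟨mem_univ _, ?_⟩
    change 1 / ((((n + 1) * C : ℕ) : ℝ) + 1) ≤ p.2
    push_cast
    rw [div_le_iff₀ (by positivity)] at h4 ⊢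
    nlinarith

theorem exists_measurable_smul_weightFiltration (g : DiffCurrent d) (n : ℕ) :
    ∃ k : ℕ, @Measurable _ _ (weightFiltration d k) (weightFiltration d n)
      fun η : DiscreteRadon d => g • η := by
  obtain ⟨k, hk⟩ := exists_isAdmissible_preimage_actPoint g n
  refine ⟨k, ?_⟩
  have : weightFiltration d n ≤
      (weightFiltration d k).map fun η : DiscreteRadon d => g • η := by
    refine weightFiltration_le_iff.2 fun Λ hΛ B hB => ?_
    have h1 := measurable_encard_markedSet (hk Λ hΛ) hB
    change MeasurableSet[weightFiltration d k]
      ((fun η : DiscreteRadon d => (markedSet Λ (g • η)).encard) ⁻¹' B)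
    simp_rw [markedSet_smul, g.right.1.injective.encard_image]
    exact h1
  exact fun A hA => this A hA

theorem exists_measurableSet_image_smul (g : DiffCurrent d) (n : ℕ) :
    ∃ k : ℕ, ∀ A : Set (DiscreteRadon d), MeasurableSet[weightFiltration d n] A →
      MeasurableSet[weightFiltration d k] ((fun η => g • η) '' A) := by
  obtain ⟨k, hk⟩ := exists_measurable_smul_weightFiltration g⁻¹ n
  refine ⟨k, fun A hA => ?_⟩
  have : (fun η => g • η) '' A = (fun η : DiscreteRadon d => g⁻¹ • η) ⁻¹' A :=
    (preimage_smul_inv g A).symm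
  rw [this]
  exact hk hA

/-! ### Absolute continuity on the filtration -/

/-- Two independent measures share no atom: given `η`, its countably many atoms are each missed by
`ζ`. The integral of `ζ {x}` against `η` expresses this measurably. -/
theorem ae_prod_forall_singleton_eq_zero_or (P Q : Measure (DiscreteRadon d))
    [IsProbabilityMeasure P] [IsProbabilityMeasure Q]
    (hQ : ∀ x : Rd d, ∀ᵐ ζ ∂Q, ζ.1 {x} = 0) :
    ∀ᵐ p ∂(P.prod Q), ∀ x, p.1.1 {x} = 0 ∨ p.2.1 {x} = 0 := by
  have hiff : ∀ η ζ : DiscreteRadon d,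
      (∀ x, η.1 {x} = 0 ∨ ζ.1 {x} = 0) ↔ ∫⁻ x, ζ.1 {x} ∂η.1 = 0 := by
    intro η ζ
    rw [DiscreteRadon.lintegral_eq_tsum, ENNReal.tsum_eq_zero]
    refine forall_congr' fun x => ?_
    rw [mul_eq_zero, or_comm]
  have hm : Measurable fun p : DiscreteRadon d × DiscreteRadon d =>
      ∫⁻ x, p.2.1 {x} ∂p.1.1 := by
    have h1 : Measurable fun q : (DiscreteRadon d × DiscreteRadon d) × Rd d => q.1.2.1 {q.2} :=
      DiscreteRadon.measurable_measure_singleton.comp (measurable_fst.snd.prodMk measurable_snd)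
    exact Measurable.lintegral_kernel_prod_right'
      (κ := (DiscreteRadon.kernel d).prodMkRight (DiscreteRadon d)) h1
  simp_rw [hiff]
  have hs : MeasurableSet {p : DiscreteRadon d × DiscreteRadon d |
      ∫⁻ x, p.2.1 {x} ∂p.1.1 = 0} := hm (measurableSet_singleton 0)
  rw [Measure.ae_prod_iff_ae_ae hs]
  refine ae_of_all _ fun η => ?_
  simp_rw [← hiff]
  have h1 : ∀ᵐ ζ ∂Q, ∀ x ∈ {x | η.1 {x} ≠ 0}, ζ.1 {x} = 0 :=
    (ae_ball_iff η.countable_setOf_measure_singleton_ne_zero).2 fun x _ => hQ x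
  filter_upwards [h1] with ζ hζ x
  by_cases hx : η.1 {x} = 0
  · exact Or.inl hx
  · exact Or.inr (hζ x hx)

/-- An atom of `ζ` stands alone in the sum and is too light to be marked. -/
theorem markedSet_add_eq {n : ℕ} {c : ℝ} (hc : c < 1 / ((n : ℝ) + 1)) {η ζ : DiscreteRadon d}
    (h : ∀ x, η.1 {x} = 0 ∨ ζ.1 {x} = 0) (hζ : ∀ x, ζ.1 {x} ≤ ENNReal.ofReal c)
    {Λ : Set (Rd d × ℝ)} (hΛ : IsAdmissible n Λ) : markedSet Λ (η + ζ) = markedSet Λ η := by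
  ext x
  change (x, ((η.1 + ζ.1) {x}).toReal) ∈ Λ ↔ (x, (η.1 {x}).toReal) ∈ Λ
  rw [Measure.add_apply]
  rcases h x with h0 | h0
  · rw [h0, zero_add]
    have hpos : 0 < 1 / ((n : ℝ) + 1) := by positivity
    refine iff_of_false (fun hx => ?_) fun hx => ?_
    · have h1 : 1 / ((n : ℝ) + 1) ≤ (ζ.1 {x}).toReal := (hΛ.subset hx).2
      -- For `c < 0` the bound `ENNReal.ofReal c` is `0`, which is treated separately.
      have h2 := (ENNReal.le_ofReal_iff_toReal_le (ζ.measure_singleton_ne_top x)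
        (le_of_not_gt fun hneg => ?_)).1 (hζ x)
      · linarith
      · have := hζ x
        rw [ENNReal.ofReal_of_nonpos hneg.le, nonpos_iff_eq_zero] at this
        rw [this, ENNReal.toReal_zero] at h1
        linarith
    · have := hΛ.pos hx
      simp at this
  · rw [h0, add_zero]

/-- On the σ-algebra generated by atoms of weight at least `1 / (n + 1)`, atoms of weight below
`c < 1 / (n + 1)` do not matter. -/
theorem apply_eq_of_restrict_Ici {m : Measure (Rd d × ℝ)} [SFinite m] (hm : IsLevy m)
    (h0 : ∀ x : Rd d, m ({x} ×ˢ univ) = 0) {n : ℕ} {c : ℝ} (hc : c < 1 / ((n : ℝ) + 1))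
    {P Q : Measure (DiscreteRadon d)} (hP : IsCompletelyRandomWithLevyMeasure m P)
    (hQ : IsCompletelyRandomWithLevyMeasure (m.restrict (univ ×ˢ Ici c)) Q)
    {A : Set (DiscreteRadon d)} (hA : MeasurableSet[weightFiltration d n] A) : P A = Q A := by
  have hI : MeasurableSet (univ ×ˢ Ici c : Set (Rd d × ℝ)) :=
    MeasurableSet.univ.prod measurableSet_Ici
  have hle : m.restrict (univ ×ˢ Ici c)ᶜ ≤ m := Measure.restrict_le_self
  -- `S` carries the jumps below `c`; adding it independently to `Q` recovers `P`, by uniqueness.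
  obtain ⟨S, hS⟩ := (hm.mono hle).exists_isCompletelyRandom
  have hadd := IsCompletelyRandomWithLevyMeasure.add (hm.mono Measure.restrict_le_self)
    (hm.mono hle) hQ hS
  rw [Measure.restrict_add_restrict_compl hI] at hadd
  have := hQ.1
  have := hS.1
  have h0' : ∀ x : Rd d, m.restrict (univ ×ˢ Ici c)ᶜ ({x} ×ˢ univ) = 0 := fun x =>
    hle.absolutelyContinuous (h0 x)
  have hA' := weightFiltration_le n A hA
  rw [hP.unique hadd, Measure.map_apply DiscreteRadon.measurable_add hA']
  have hsmall : ∀ᵐ p ∂(m.restrict (univ ×ˢ Ici c)ᶜ), p.2 ≤ c := by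
    filter_upwards [ae_restrict_mem hI.compl] with p hp
    by_contra h
    exact hp ⟨mem_univ _, (not_le.1 h).le⟩
  have h1 : (fun p : DiscreteRadon d × DiscreteRadon d => p.1 + p.2) ⁻¹' A
      =ᵐ[Q.prod S] Prod.fst ⁻¹' A := by
    filter_upwards [ae_prod_forall_singleton_eq_zero_or Q S fun x =>
        hS.ae_measure_singleton (hm.mono hle) (h0' x),
      Measure.quasiMeasurePreserving_snd.ae
        (hS.ae_forall_measure_singleton_le (hm.mono hle) h0' hsmall)] with p hp1 hp2
    exact propext (mem_iff_mem_of_markedSet_eq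
      (fun Λ hΛ => markedSet_add_eq hc hp1 hp2 hΛ) hA)
  rw [measure_congr h1, ← prod_univ, Measure.prod_prod, measure_univ, mul_one]

/-- Markov's inequality for `min 1 s`, which is at least `min 1 c` on the set. -/
theorem IsLevy.isFiniteMeasure_restrict {m : Measure (Rd d × ℝ)} (hm : IsLevy m) {K : Set (Rd d)}
    (hK : IsCompact K) {c : ℝ} (hc : 0 < c) :
    IsFiniteMeasure (m.restrict (K ×ˢ univ ∩ univ ×ˢ Ici c)) := by
  obtain ⟨r, hr⟩ := hK.isBounded.subset_closedBall (0 : Rd d)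
  obtain ⟨R, hR⟩ := exists_nat_ge r
  have hI : MeasurableSet (univ ×ˢ Ici c : Set (Rd d × ℝ)) :=
    MeasurableSet.univ.prod measurableSet_Ici
  have h1 : ENNReal.ofReal (min 1 c) * m (K ×ˢ univ ∩ univ ×ˢ Ici c) < ∞ := by
    refine lt_of_le_of_lt ?_ (hm.lintegral_lt_top R)
    calc ENNReal.ofReal (min 1 c) * m (K ×ˢ univ ∩ univ ×ˢ Ici c)
        ≤ ENNReal.ofReal (min 1 c) *
            m (univ ×ˢ Ici c ∩ Metric.closedBall (0 : Rd d) R ×ˢ univ) := by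
          refine mul_le_mul le_rfl (measure_mono ?_) zero_le zero_le
          rw [inter_comm]
          exact inter_subset_inter_right _ (prod_mono
            (hr.trans (Metric.closedBall_subset_closedBall hR)) le_rfl)
      _ = ∫⁻ _ in univ ×ˢ Ici c, ENNReal.ofReal (min 1 c)
            ∂(m.restrict (Metric.closedBall (0 : Rd d) R ×ˢ univ)) := by
          rw [setLIntegral_const, Measure.restrict_apply hI]
      _ ≤ ∫⁻ p in univ ×ˢ Ici c, ENNReal.ofReal (min 1 p.2)
            ∂(m.restrict (Metric.closedBall (0 : Rd d) R ×ˢ univ)) :=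
          setLIntegral_mono (Measurable.ennreal_ofReal (by fun_prop)) fun p hp =>
            ENNReal.ofReal_le_ofReal (min_le_min le_rfl hp.2)
      _ ≤ _ := setLIntegral_le_lintegral _ _
  refine ⟨?_⟩
  rw [Measure.restrict_apply_univ]
  by_contra htop
  rw [not_lt_top_iff.1 htop, ENNReal.mul_top
    (ENNReal.ofReal_pos.2 (lt_min one_pos hc)).ne'] at h1
  exact lt_irrefl _ h1

/-- Without jumps below `c`, both laws are independent sums of one common part `W` off `K` and a
compound Poisson part over `K`. Only the latter differ, and they are comparable because their Lévy
measures are finite. -/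
theorem apply_eq_zero_of_absolutelyContinuous {m m' : Measure (Rd d × ℝ)} [SFinite m] [SFinite m']
    (hm : IsLevy m) (hm' : IsLevy m') (h0 : ∀ x : Rd d, m ({x} ×ˢ univ) = 0) (hac : m' ≪ m)
    {K : Set (Rd d)} (hK : IsCompact K)
    (heq : m'.restrict (K ×ˢ univ)ᶜ = m.restrict (K ×ˢ univ)ᶜ)
    {P P' : Measure (DiscreteRadon d)} (hP : IsCompletelyRandomWithLevyMeasure m P)
    (hP' : IsCompletelyRandomWithLevyMeasure m' P') {n : ℕ} {A : Set (DiscreteRadon d)}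
    (hA : MeasurableSet[weightFiltration d n] A) (hPA : P A = 0) : P' A = 0 := by
  obtain ⟨c, hc0, hc⟩ : ∃ c : ℝ, 0 < c ∧ c < 1 / ((n : ℝ) + 1) := exists_between (by positivity)
  set H : Set (Rd d × ℝ) := univ ×ˢ Ici c
  set V : Set (Rd d × ℝ) := K ×ˢ univ
  have hVm : MeasurableSet V := hK.measurableSet.prod MeasurableSet.univ
  have hfin : IsFiniteMeasure (m.restrict (V ∩ H)) := hm.isFiniteMeasure_restrict hK hc0
  have hfin' : IsFiniteMeasure (m'.restrict (V ∩ H)) := hm'.isFiniteMeasure_restrict hK hc0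
  have hsplit : ∀ ρ : Measure (Rd d × ℝ),
      ρ.restrict (V ∩ H) + (ρ.restrict Vᶜ).restrict H = ρ.restrict H := by
    intro ρ
    have hHm : MeasurableSet H := MeasurableSet.univ.prod measurableSet_Ici
    have h1 : ρ.restrict (V ∩ H) = (ρ.restrict V).restrict H := by
      rw [Measure.restrict_restrict hHm, inter_comm]
    rw [h1, ← Measure.restrict_add, Measure.restrict_add_restrict_compl hVm]
  obtain ⟨W, hW⟩ := (hm.mono (m' := (m.restrict Vᶜ).restrict H)
    (Measure.restrict_le_self.trans Measure.restrict_le_self)).exists_isCompletelyRandom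
  have hLW : IsLevy ((m.restrict Vᶜ).restrict H) :=
    hm.mono (Measure.restrict_le_self.trans Measure.restrict_le_self)
  have hL : IsLevy (m.restrict (V ∩ H)) := hm.mono Measure.restrict_le_self
  have hL' : IsLevy (m'.restrict (V ∩ H)) := hm'.mono Measure.restrict_le_self
  have hQ := IsCompletelyRandomWithLevyMeasure.add hL hLW
    (isCompletelyRandom_finiteLaw hL.ae_pos) hW
  have hQ' := IsCompletelyRandomWithLevyMeasure.add hL' hLW
    (isCompletelyRandom_finiteLaw hL'.ae_pos) hW
  rw [hsplit] at hQ
  -- Off `K` the two Lévy measures agree, so the same `W` serves for `m'`.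
  rw [← heq, hsplit] at hQ'
  have := hW.1
  rw [apply_eq_of_restrict_Ici hm h0 hc hP hQ hA] at hPA
  rw [apply_eq_of_restrict_Ici hm' (fun x => hac (h0 x)) hc hP' hQ' hA]
  exact (((finiteLaw_absolutelyContinuous (hac.restrict (V ∩ H))).prod
    Measure.AbsolutelyContinuous.rfl).map DiscreteRadon.measurable_add) hPA

/-- Radon–Nikodym for the restrictions of `P` and `Q` to the smaller σ-algebra. -/
theorem exists_density_of_absolutelyContinuous {α : Type*} {m m0 : MeasurableSpace α}
    (hm : m ≤ m0) (P Q : Measure[m0] α) [IsFiniteMeasure P] [IsFiniteMeasure Q]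
    (h : ∀ A, MeasurableSet[m] A → P A = 0 → Q A = 0) :
    ∃ R : α → ℝ≥0∞, Measurable[m0] R ∧ ∀ F : α → ℝ≥0∞, Measurable[m] F →
      ∫⁻ a, F a ∂Q = ∫⁻ a, F a * R a ∂P := by
  have hac : Q.trim hm ≪ P.trim hm := by
    refine Measure.AbsolutelyContinuous.mk fun A hA hPA => ?_
    rw [trim_measurableSet_eq hm hA] at hPA ⊢
    exact h A hA hPA
  have hR := Measure.measurable_rnDeriv (Q.trim hm) (P.trim hm)
  refine ⟨(Q.trim hm).rnDeriv (P.trim hm), hR.mono hm le_rfl, fun F hF => ?_⟩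
  rw [← lintegral_trim hm hF, ← lintegral_rnDeriv_mul hac hF.aemeasurable]
  simp_rw [mul_comm _ (F _)]
  exact lintegral_trim hm (hF.mul hR)

/-! ### The image of a Lévy measure under the group -/

theorem integral_smul_discreteRadon (g : DiffCurrent d) (η : DiscreteRadon d) (f : Rd d → ℝ) :
    ∫ x, f x ∂(g • η).1 =
      ∫ x, (g.left.1 (g.right.1 x) : ℝ) * f (g.right.1 x) ∂η.1 := by
  have hemb : MeasurableEmbedding (g.right.1 : Rd d → Rd d) :=
    (Homeomorph.mk g.right.1 g.right.2.1.continuous g.right.2.2.1.continuous).measurableEmbedding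
  change ∫ x, f x ∂((η.1.map (g.right.1 : Rd d → Rd d)).withDensity (Current.density g.left)) = _
  rw [integral_withDensity_eq_integral_toReal_smul (Current.measurable_density g.left)
    (ae_of_all _ fun x => ENNReal.ofReal_lt_top), hemb.integral_map]
  simp only [Current.density, smul_eq_mul]
  refine integral_congr_ae (ae_of_all _ fun x => ?_)
  simp only [ENNReal.toReal_ofReal (g.left.1 (g.right.1 x)).2.le]

/-- Integrating `f` against `g • η` is integrating the test function `(θ ∘ φ) (f ∘ φ)` against `η`;
the same substitution acts on the Lévy exponent. -/
theorem IsCompletelyRandomWithLevyMeasure.map_smul {m : Measure (Rd d × ℝ)}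
    {P : Measure (DiscreteRadon d)} (hP : IsCompletelyRandomWithLevyMeasure m P)
    (g : DiffCurrent d) :
    IsCompletelyRandomWithLevyMeasure (m.map (actPoint g)) (P.map fun η => g • η) := by
  have := hP.1
  have hsm : Measurable fun η : DiscreteRadon d => g • η := measurable_const_smul g
  refine ⟨Measure.isProbabilityMeasure_map hsm.aemeasurable, fun f hf hc => ?_⟩
  have hφ : Continuous (g.right.1 : Rd d → Rd d) := g.right.2.1.continuous
  have hf' : Continuous fun x => (g.left.1 (g.right.1 x) : ℝ) * f (g.right.1 x) :=
    ((continuous_current g.left).comp hφ).mul (hf.comp hφ)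
  have hc' : HasCompactSupport fun x => (g.left.1 (g.right.1 x) : ℝ) * f (g.right.1 x) :=
    (hc.comp_homeomorph (Homeomorph.mk g.right.1 hφ g.right.2.2.1.continuous)).mul_left
  have h1 := hP.2 _ hf' hc'
  change ∫ η, fourierFun f η ∂_ = _
  rw [integral_map hsm.aemeasurable
    (isMultiplicative_fourierFun hf hc).measurable.aestronglyMeasurable,
    integral_map (continuous_actPoint g).measurable.aemeasurable
      (Measurable.aestronglyMeasurable (by have := hf.measurable; fun_prop))]
  simp only [fourierFun, integral_smul_discreteRadon]
  rw [h1]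
  congr 1
  refine integral_congr_ae (ae_of_all _ fun p => ?_)
  simp only [actPoint]
  congr 4
  ring

theorem IsLevy.map_actPoint {m : Measure (Rd d × ℝ)} (hm : IsLevy m) (g : DiffCurrent d) :
    IsLevy (m.map (actPoint g)) := by
  have hmeas : Measurable (actPoint g) := (continuous_actPoint g).measurable
  refine ⟨?_, fun R => ?_⟩
  · have hs : MeasurableSet {p : Rd d × ℝ | 0 < p.2} := measurable_snd measurableSet_Ioi
    rw [ae_map_iff hmeas.aemeasurable hs]
    filter_upwards [hm.ae_pos] with p hp
    exact mul_pos (g.left.1 _).2 hp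
  · obtain ⟨C, hC0, hC⟩ := exists_nat_current_le g.left
    have hK : IsCompact (g.right.1.symm '' Metric.closedBall (0 : Rd d) R) :=
      (isCompact_closedBall _ _).image g.right.2.2.1.continuous
    obtain ⟨r, hr⟩ := hK.isBounded.subset_closedBall (0 : Rd d)
    obtain ⟨R', hR'⟩ := exists_nat_ge r
    have hB : MeasurableSet (Metric.closedBall (0 : Rd d) R ×ˢ (univ : Set ℝ)) :=
      Metric.isClosed_closedBall.measurableSet.prod MeasurableSet.univ
    rw [setLIntegral_map hB (Measurable.ennreal_ofReal (by fun_prop)) hmeas]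
    calc ∫⁻ p in actPoint g ⁻¹' (Metric.closedBall (0 : Rd d) R ×ˢ univ),
          ENNReal.ofReal (min 1 (actPoint g p).2) ∂m
        ≤ ∫⁻ p in Metric.closedBall (0 : Rd d) R' ×ˢ univ,
          ENNReal.ofReal (min 1 (actPoint g p).2) ∂m := by
          refine lintegral_mono_set fun p hp => ⟨?_, mem_univ _⟩
          refine Metric.closedBall_subset_closedBall hR' (hr ?_)
          exact ⟨g.right.1 p.1, hp.1, g.right.1.symm_apply_apply _⟩
      _ ≤ ∫⁻ p in Metric.closedBall (0 : Rd d) R' ×ˢ univ,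
          ENNReal.ofReal C * ENNReal.ofReal (min 1 p.2) ∂m := by
          refine lintegral_mono_ae ?_
          filter_upwards [ae_restrict_of_ae hm.ae_pos] with p hp
          rw [← ENNReal.ofReal_mul (Nat.cast_nonneg C)]
          refine ENNReal.ofReal_le_ofReal ?_
          have h1 : (1 : ℝ) ≤ C := by exact_mod_cast hC0
          change min 1 ((g.left.1 (g.right.1 p.1) : ℝ) * p.2) ≤ C * min 1 p.2
          rcases le_total 1 p.2 with h2 | h2
          · rw [min_eq_left h2, mul_one]
            exact (min_le_left _ _).trans h1
          · rw [min_eq_right h2]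
            exact (min_le_right _ _).trans (mul_le_mul_of_nonneg_right (hC _) hp.le)
      _ = ENNReal.ofReal C * ∫⁻ p in Metric.closedBall (0 : Rd d) R' ×ˢ univ,
          ENNReal.ofReal (min 1 p.2) ∂m :=
          lintegral_const_mul _ (Measurable.ennreal_ofReal (by fun_prop))
      _ < ∞ := ENNReal.mul_lt_top ENNReal.ofReal_lt_top (hm.lintegral_lt_top R')

theorem exists_isCompact_restrict_map_actPoint (g : DiffCurrent d) :
    ∃ K : Set (Rd d), IsCompact K ∧ ∀ m : Measure (Rd d × ℝ),
      (m.map (actPoint g)).restrict (K ×ˢ univ)ᶜ = m.restrict (K ×ˢ univ)ᶜ := by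
  obtain ⟨K₁, hK₁, h₁⟩ := g.right.2.2.2
  obtain ⟨K₂, hK₂, h₂⟩ := g.left.2.2
  refine ⟨K₁ ∪ K₂, hK₁.union hK₂, fun m => ?_⟩
  have hVm : MeasurableSet ((K₁ ∪ K₂) ×ˢ (univ : Set ℝ))ᶜ :=
    ((hK₁.union hK₂).measurableSet.prod MeasurableSet.univ).compl
  have hfix : ∀ p : Rd d × ℝ, p.1 ∉ K₁ ∪ K₂ → actPoint g p = p := by
    intro p hp
    rw [mem_union, not_or] at hp
    rw [actPoint, h₁ _ hp.1, h₂ _ hp.2]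
    simp
  -- If `φ x` is off `K₁` then `φ` fixes it, so `x = φ x` by injectivity: no atom is moved out of
  -- `K`.
  have hfix' : ∀ p : Rd d × ℝ, (actPoint g p).1 ∉ K₁ ∪ K₂ → p.1 ∉ K₁ ∪ K₂ := by
    intro p hp
    have h3 : g.right.1 (g.right.1 p.1) = g.right.1 p.1 := h₁ _ fun h => hp (Or.inl h)
    rw [← g.right.1.injective h3]
    exact hp
  ext B hB
  have hmeas : Measurable (actPoint g) := (continuous_actPoint g).measurable
  rw [Measure.restrict_apply hB, Measure.restrict_apply hB,
    Measure.map_apply hmeas (hB.inter hVm)]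
  congr 1
  ext p
  constructor
  · intro hp
    have h3 : (actPoint g p).1 ∉ K₁ ∪ K₂ := fun h => hp.2 ⟨h, mem_univ _⟩
    rw [mem_preimage, hfix p (hfix' p h3)] at hp
    exact hp
  · intro hp
    have h3 : p.1 ∉ K₁ ∪ K₂ := fun h => hp.2 ⟨h, mem_univ _⟩
    rw [mem_preimage, hfix p h3]
    exact hp

theorem IsCompletelyRandomWithLevyMeasure.partiallyQuasiInvariantAlong
    {m : Measure (Rd d × ℝ)} [SFinite m] (hm : IsLevy m) (h0 : ∀ x : Rd d, m ({x} ×ˢ univ) = 0)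
    (hac : ∀ g : DiffCurrent d, m.map (actPoint g) ≪ m) {P : Measure (DiscreteRadon d)}
    (hP : IsCompletelyRandomWithLevyMeasure m P) :
    PartiallyQuasiInvariantAlong (DiffCurrent d) (weightFiltration d) P := by
  refine ⟨weightFiltration_mono, iSup_weightFiltration,
    fun g n => exists_measurableSet_image_smul g n, fun g n => ?_⟩
  have := hP.1
  obtain ⟨K, hK, heq⟩ := exists_isCompact_restrict_map_actPoint g
  have hPg := hP.map_smul g
  have := hPg.1
  exact exists_density_of_absolutelyContinuous (weightFiltration_le n) P _ fun A hA hPA =>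
    apply_eq_zero_of_absolutelyContinuous hm (hm.map_actPoint g) h0 (hac g) hK (heq m) hP hPg
      hA hPA

/-! ### Lévy measures with a density -/

/-- Lebesgue measure on `X × (0, ∞)`. -/
noncomputable abbrev halfVolume (d : ℕ) : Measure (Rd d × ℝ) :=
  (volume : Measure (Rd d)).prod ((volume : Measure ℝ).restrict (Ioi 0))

theorem halfVolume_singleton_prod (hd : 0 < d) (x : Rd d) :
    halfVolume d ({x} ×ˢ univ) = 0 := by
  have : Nonempty (Fin d) := ⟨⟨0, hd⟩⟩
  rw [halfVolume, Measure.prod_prod, measure_singleton, zero_mul]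

theorem levyMeasure_absolutelyContinuous (l : Rd d → ℝ → ℝ) : levyMeasure l ≪ halfVolume d :=
  withDensity_absolutelyContinuous _ _

theorem ae_halfVolume_pos : ∀ᵐ p ∂(halfVolume d), 0 < p.2 :=
  Measure.quasiMeasurePreserving_snd.ae (ae_restrict_mem measurableSet_Ioi)

/-- By Fubini, null sets are tested fibrewise: the inverse diffeomorphism maps null sets to null
sets, and on each fibre the action is a positive dilation. -/
theorem map_actPoint_halfVolume_absolutelyContinuous (g : DiffCurrent d) :
    (halfVolume d).map (actPoint g) ≪ halfVolume d := by
  have hmeas : Measurable (actPoint g) := (continuous_actPoint g).measurable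
  refine Measure.AbsolutelyContinuous.mk fun B hB hB0 => ?_
  rw [Measure.map_apply hmeas hB]
  rw [Measure.measure_prod_null hB] at hB0
  rw [Measure.measure_prod_null (hmeas hB)]
  have hφ : Measure.QuasiMeasurePreserving (g.right.1 : Rd d → Rd d) volume volume := by
    refine ⟨g.right.2.1.continuous.measurable, Measure.AbsolutelyContinuous.mk fun N hN hN0 => ?_⟩
    rw [Measure.map_apply g.right.2.1.continuous.measurable hN,
      ← Equiv.image_symm_eq_preimage]
    refine addHaar_image_eq_zero_of_differentiableOn_of_addHaar_eq_zero volume ?_ hN0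
    exact (g.right.2.2.1.differentiable (by simp)).differentiableOn
  filter_upwards [hφ.ae hB0] with x hx
  set a : ℝ := (g.left.1 (g.right.1 x) : ℝ)
  have ha0 : 0 < a := (g.left.1 (g.right.1 x)).2
  have hBx : MeasurableSet (Prod.mk (g.right.1 x) ⁻¹' B) := measurable_prodMk_left hB
  have h1 : Prod.mk x ⁻¹' (actPoint g ⁻¹' B) =
      (fun s : ℝ => a * s) ⁻¹' (Prod.mk (g.right.1 x) ⁻¹' B) := rfl
  have h2 : (volume : Measure ℝ) (Prod.mk (g.right.1 x) ⁻¹' B ∩ Ioi 0) = 0 := by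
    rw [← Measure.restrict_apply hBx]
    exact hx
  have h3 : (fun s : ℝ => a * s) ⁻¹' (Prod.mk (g.right.1 x) ⁻¹' B) ∩ Ioi 0 =
      (fun s : ℝ => a * s) ⁻¹' (Prod.mk (g.right.1 x) ⁻¹' B ∩ Ioi 0) := by
    ext s
    simp [ha0]
  change (volume : Measure ℝ).restrict (Ioi 0) (Prod.mk x ⁻¹' (actPoint g ⁻¹' B)) = 0
  rw [h1, Measure.restrict_apply ((measurable_const_mul a) hBx), h3,
    Real.volume_preimage_mul_left ha0.ne', h2, mul_zero]

section Density

variable {l : Rd d → ℝ → ℝ}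

theorem measurable_levyDensity (hl : Measurable fun p : Rd d × ℝ => l p.1 p.2) :
    Measurable fun p : Rd d × ℝ => ENNReal.ofReal (l p.1 p.2 / p.2) :=
  (hl.div measurable_snd).ennreal_ofReal

/-- By the dichotomy it suffices to test `s = 1`. -/
theorem measurableSet_posSet (hl : Measurable fun p : Rd d × ℝ => l p.1 p.2)
    (hdich : ∀ x, (∀ s : ℝ, 0 < s → 0 < l x s) ∨ (∀ s : ℝ, 0 < s → l x s = 0)) :
    MeasurableSet (posSet l) := by
  have : posSet l = {x | 0 < l x 1} := by
    ext x
    refine ⟨fun h => h 1 one_pos, fun h => (hdich x).resolve_right fun h' => ?_⟩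
    exact (ne_of_gt (show 0 < l x 1 from h)) (h' 1 one_pos)
  rw [this]
  exact (hl.comp (measurable_id.prodMk measurable_const)) measurableSet_Ioi

theorem halfVolume_absolutelyContinuous_levyMeasure
    (hl : Measurable fun p : Rd d × ℝ => l p.1 p.2) (hpos : ∀ᵐ x, x ∈ posSet l) :
    halfVolume d ≪ levyMeasure l := by
  refine withDensity_absolutelyContinuous' (measurable_levyDensity hl).aemeasurable ?_
  filter_upwards [Measure.quasiMeasurePreserving_fst.ae hpos, ae_halfVolume_pos] with p hp hp2
  exact (ENNReal.ofReal_pos.2 (div_pos (hp p.2 hp2) hp2)).ne'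

/-- `(l / s) min(1, s) = l min(s⁻¹, 1)`, and a ball differs from its part in `posSet l` by a null
set. -/
theorem isLevy_levyMeasure (hl : Measurable fun p : Rd d × ℝ => l p.1 p.2)
    (hdich : ∀ x, (∀ s : ℝ, 0 < s → 0 < l x s) ∨ (∀ s : ℝ, 0 < s → l x s = 0))
    (hpos : ∀ᵐ x, x ∈ posSet l)
    (hint : ∀ A, IsBddBorelIn (posSet l) A →
      ∫⁻ x in A, ∫⁻ s in Ioi (0 : ℝ), ENNReal.ofReal (l x s * min s⁻¹ 1) < ∞) :
    IsLevy (levyMeasure l) := by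
  refine ⟨(levyMeasure_absolutelyContinuous l).ae_le ae_halfVolume_pos, fun R => ?_⟩
  have hY := measurableSet_posSet hl hdich
  have hR : MeasurableSet (Metric.closedBall (0 : Rd d) R) :=
    Metric.isClosed_closedBall.measurableSet
  have hA := hint (Metric.closedBall 0 R ∩ posSet l) ⟨hR.inter hY,
    (isCompact_closedBall _ _).closure_of_subset inter_subset_left, inter_subset_right⟩
  have hAe : (Metric.closedBall (0 : Rd d) R ∩ posSet l : Set (Rd d)) =ᵐ[volume]
      Metric.closedBall (0 : Rd d) R := by
    filter_upwards [hpos] with x hx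
    exact propext ⟨fun h => h.1, fun h => ⟨h, hx⟩⟩
  rw [Measure.restrict_congr_set hAe] at hA
  refine lt_of_eq_of_lt ?_ hA
  have hmin : Measurable fun p : Rd d × ℝ => ENNReal.ofReal (min 1 p.2) :=
    Measurable.ennreal_ofReal (by fun_prop)
  rw [levyMeasure, restrict_withDensity (hR.prod MeasurableSet.univ),
    lintegral_withDensity_eq_lintegral_mul _ (measurable_levyDensity hl) hmin,
    ← Measure.prod_restrict, Measure.restrict_univ,
    lintegral_prod _ ((measurable_levyDensity hl).mul hmin).aemeasurable]
  refine lintegral_congr_ae ?_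
  filter_upwards [ae_restrict_of_ae hpos] with x hx
  refine setLIntegral_congr_fun measurableSet_Ioi fun s hs => ?_
  have hs0 : (0 : ℝ) < s := hs
  rw [Pi.mul_apply, ← ENNReal.ofReal_mul (div_nonneg (hx s hs0).le hs0.le)]
  congr 1
  change l x s / s * min 1 s = _
  rw [div_eq_mul_inv, mul_assoc, mul_min_of_nonneg _ _ (inv_nonneg.2 hs0.le), mul_one,
    inv_mul_cancel₀ hs0.ne']

end Density

end PQI

theorem theorem5p3 (d : ℕ) (hd : 0 < d) (l : PQI.Rd d → ℝ → ℝ)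
    (hl_meas : Measurable fun p : PQI.Rd d × ℝ => l p.1 p.2)
    -- for each `x`, either `l(x, ·) > 0` or `l(x, ·) = 0` on `(0, ∞)`
    (hl_dichotomy : ∀ x, (∀ s : ℝ, 0 < s → 0 < l x s) ∨ (∀ s : ℝ, 0 < s → l x s = 0))
    -- the first alternative holds for almost every `x`
    (hl_pos : ∀ᵐ x, x ∈ PQI.posSet l)
    (hl_int : ∀ A, PQI.IsBddBorelIn (PQI.posSet l) A →
      ∫⁻ x in A, ∫⁻ s in Ioi (0 : ℝ), ENNReal.ofReal (l x s * min s⁻¹ 1) < ∞)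
    (hl_dil : ∀ n : ℕ, 1 ≤ n → ∃ ε : ℝ, 0 < ε ∧ ∀ A, PQI.IsBddBorelIn (PQI.posSet l) A →
      ∫⁻ x in A, (⨆ r ∈ Icc (1 / (n : ℝ)) (n : ℝ),
        ∫⁻ s in Ioo 0 ε, ENNReal.ofReal (|l x (r * s) - l x s| / s)) < ∞)
    (hl_inf : ∃ Λ, PQI.IsBddBorelIn univ Λ ∧ PQI.levyMeasure l (Λ ×ˢ Ioi 0) = ∞) :
    (∃! μ : Measure (PQI.DiscreteRadon d),
      PQI.IsCompletelyRandomWithLevyMeasure (PQI.levyMeasure l) μ) ∧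
    ∀ μ : Measure (PQI.DiscreteRadon d),
      PQI.IsCompletelyRandomWithLevyMeasure (PQI.levyMeasure l) μ →
        PQI.PartiallyQuasiInvariant (PQI.DiffCurrent d) μ ∧
        PQI.PartiallyQuasiInvariantAlong (PQI.DiffCurrent d) (PQI.weightFiltration d) μ := by
  have hL := PQI.isLevy_levyMeasure hl_meas hl_dichotomy hl_pos hl_int
  have hsf : SFinite (PQI.levyMeasure l) := by
    rw [PQI.levyMeasure]
    infer_instance
  have h0 : ∀ x : PQI.Rd d, PQI.levyMeasure l ({x} ×ˢ univ) = 0 := fun x =>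
    PQI.levyMeasure_absolutelyContinuous l (PQI.halfVolume_singleton_prod hd x)
  -- The chain is image of `m` ≪ image of Lebesgue ≪ Lebesgue ≪ `m`.
  have hac : ∀ g : PQI.DiffCurrent d,
      (PQI.levyMeasure l).map (PQI.actPoint g) ≪ PQI.levyMeasure l := fun g =>
    (((PQI.levyMeasure_absolutelyContinuous l).map
      (PQI.continuous_actPoint g).measurable).trans
      (PQI.map_actPoint_halfVolume_absolutelyContinuous g)).trans
      (PQI.halfVolume_absolutelyContinuous_levyMeasure hl_meas hl_pos)
  refine ⟨?_, fun μ hμ => ?_⟩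
  · obtain ⟨P, hP⟩ := hL.exists_isCompletelyRandom
    exact ⟨P, hP, fun Q hQ => PQI.IsCompletelyRandomWithLevyMeasure.unique hQ hP⟩
  · have h := hμ.partiallyQuasiInvariantAlong hL h0 hac
    exact ⟨⟨_, h⟩, h⟩
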